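/- For $R>0$ let $\Omega_R=(-\pi,\pi)\times(-R,R)$. Let $\alpha\in\mathbb R$, let $k\in\mathbb C$ with $\operatorname{Re}k\ge 0$ and $\operatorname{Im}k\ge 0$ (for instance $k>0$ or $k=\mathrm i$), put $\alpha_j=j+\alpha$ for $j\in\mathbb Z$, and assume that $k^2\ne\alpha_j^2$ for all $j\in\mathbb Z$. Let $\beta_j=(k^2-\alpha_j^2)^{1/2}$ (principal branch, so that $\operatorname{Re}\beta_j\ge0$ and $\operatorname{Im}\beta_j\ge0$), and let $$G_{k,\alpha}(x)=\frac{\mathrm i}{4\pi}\sum_{j\in\mathbb Z}\frac1{\beta_j}\,e^{\mathrm i\alpha_jx_1+\mathrm i\beta_j|x_2|},\qquad x\in\mathbb R^2,\ x\ne(2\pi m,0)\text{ for all }m\in\mathbb Z,$$ be the $\alpha$-quasi-periodic Green's function of the Helmholtz equation (the series being the limit of its partial sums over $-N\le j\le N$). Let $D$ be a measurable set with $D\subset\Omega_\rho$ for some $\rho>0$. For $\ell\in\mathbb N$ and $R>0$, let $H^\ell_\alpha(\Omega_R)$ be the space of those $u\in H^\ell(\Omega_R)$ that are the restriction to $\Omega_R$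 of some $U\in H^\ell_{\mathrm{loc}}(\mathbb R^2)$ with $U(x_1+2\pi,x_2)=e^{2\pi\mathrm i\alpha}U(x_1,x_2)$, equipped with the norm of $H^\ell(\Omega_R)$, $\|u\|_{H^\ell(\Omega_R)}^2=\sum_{|m|\le\ell}\|\partial^mu\|_{L^2(\Omega_R)}^2$. Then, for all $f\in L^2(D)$ and $x\in\mathbb R^2$, the integral $$(V_kf)(x)=\int_DG_{k,\alpha}(x-y)f(y)\,\mathrm dy$$ converges absolutely, and for every $R>0$ the linear operator $V_k$ is bounded from $L^2(D)$ into $H^2_\alpha(\Omega_R)$: $V_kf\in H^2_\alpha(\Omega_R)$ for all $f\in L^2(D)$, and there is a constant $C$ (independent of $f$) with $\|V_kf\|_{H^2(\Omega_R)}\le C\,\|f\|_{L^2(D)}$ for all $f\in L^2(D)$. -/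

import Mathlib

open MeasureTheory
open scoped ContDiff ENNReal NNReal

noncomputable section

namespace QPVolumePotential

/-- `α_j = j + α`. -/
def alphaj (α : ℝ) (j : ℤ) : ℝ := (j : ℝ) + α

/-- `β_j = (k² - α_j²)^{1/2}`, principal branch: for `k` in the closed first quadrant the radicand
lies in the closed upper half plane, so `β_j` has nonnegative real and imaginary parts. -/
def betaj (k : ℂ) (α : ℝ) (j : ℤ) : ℂ := (k ^ 2 - (alphaj α j : ℂ) ^ 2) ^ (1 / 2 : ℂ)

/-- The `α`-quasi-periodic Green's function
`G_{k,α}(x) = (i / 4π) ∑_j (1 / β_j) exp(i α_j x₁ + i β_j |x₂|)`.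
The series converges absolutely for `x₂ ≠ 0` and only conditionally for `x₂ = 0`, `x₁ ∉ 2πℤ`;
it is the limit of the partial sums over `-N ≤ j ≤ N`. -/
def green (k : ℂ) (α : ℝ) (x : ℝ × ℝ) : ℂ :=
  Complex.I / (4 * (Real.pi : ℂ)) *
    ∑'[SummationFilter.symmetricIcc ℤ] j : ℤ, (1 / betaj k α j) *
      Complex.exp (Complex.I * (alphaj α j : ℂ) * (x.1 : ℂ)
        + Complex.I * betaj k α j * ((|x.2| : ℝ) : ℂ))

/-- The volume potential `(V_k f)(x) = ∫_D G_{k,α}(x - y) f(y) dy`. -/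
def volumePotential (k : ℂ) (α : ℝ) (D : Set (ℝ × ℝ))
    (f : Lp ℂ 2 ((volume : Measure (ℝ × ℝ)).restrict D)) : ℝ × ℝ → ℂ :=
  fun x => ∫ y in D, green k α (x - y) * f y

/-- `Ω_R = (-π, π) × (-R, R)`. -/
def cell (R : ℝ) : Set (ℝ × ℝ) := Set.Ioo (-Real.pi) Real.pi ×ˢ Set.Ioo (-R) R

/-- The open Euclidean disc in the plane. -/
def disc (c : ℝ × ℝ) (r : ℝ) : Set (ℝ × ℝ) :=
  {x | (x.1 - c.1) ^ 2 + (x.2 - c.2) ^ 2 < r ^ 2}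

/-- Classical partial derivative in `x₁`. -/
def pderiv₁ (φ : ℝ × ℝ → ℂ) : ℝ × ℝ → ℂ := fun x => fderiv ℝ φ x (1, 0)

/-- Classical partial derivative in `x₂`. -/
def pderiv₂ (φ : ℝ × ℝ → ℂ) : ℝ × ℝ → ℂ := fun x => fderiv ℝ φ x (0, 1)

/-- `v` is the weak derivative `∂₁^{m₁} ∂₂^{m₂} u` in the open set `U`. -/
def HasWeakDeriv (U : Set (ℝ × ℝ)) (m : ℕ × ℕ) (u v : ℝ × ℝ → ℂ) : Prop :=
  LocallyIntegrableOn u U ∧ LocallyIntegrableOn v U ∧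
    ∀ φ : ℝ × ℝ → ℂ, ContDiff ℝ ∞ φ → HasCompactSupport φ → tsupport φ ⊆ U →
      ∫ x in U, u x * (pderiv₁^[m.1] (pderiv₂^[m.2] φ)) x
        = (-1) ^ (m.1 + m.2) * ∫ x in U, v x * φ x

open Classical in
/-- The weak derivative of `u` in `U` of multi-index `m`, unique up to null sets
(and `0` if there is none). -/
def weakDeriv (U : Set (ℝ × ℝ)) (m : ℕ × ℕ) (u : ℝ × ℝ → ℂ) : ℝ × ℝ → ℂ :=
  if h : ∃ v, HasWeakDeriv U m u v then h.choose else 0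

/-- `u ∈ H^ℓ(U)`: all weak derivatives up to order `ℓ` exist and lie in `L²(U)`. -/
def MemH (ℓ : ℕ) (U : Set (ℝ × ℝ)) (u : ℝ × ℝ → ℂ) : Prop :=
  ∀ m : ℕ × ℕ, m.1 + m.2 ≤ ℓ →
    ∃ v, HasWeakDeriv U m u v ∧ MemLp v 2 ((volume : Measure (ℝ × ℝ)).restrict U)

/-- The norm `(∑_{|m| ≤ ℓ} ‖∂^m u‖²_{L²(U)})^{1/2}` of a function `u ∈ H^ℓ(U)`. -/
def normH (ℓ : ℕ) (U : Set (ℝ × ℝ)) (u : ℝ × ℝ → ℂ) : ℝ≥0∞ :=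
  (∑ n ∈ Finset.range (ℓ + 1), ∑ m ∈ Finset.HasAntidiagonal.antidiagonal n,
    eLpNorm (weakDeriv U m u) 2 ((volume : Measure (ℝ × ℝ)).restrict U) ^ 2) ^ (1 / 2 : ℝ)

/-- `u ∈ H^ℓ_loc(ℝ²)`: `u ∈ H^ℓ(B)` for all open discs `B`. -/
def MemHloc (ℓ : ℕ) (u : ℝ × ℝ → ℂ) : Prop := ∀ c r, MemH ℓ (disc c r) u

/-- `u(x₁ + 2π, x₂) = e^{2πiα} u(x₁, x₂)`. -/
def IsQuasiPeriodic (α : ℝ) (u : ℝ × ℝ → ℂ) : Prop :=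
  ∀ x₁ x₂ : ℝ, u (x₁ + 2 * Real.pi, x₂)
    = Complex.exp (2 * (Real.pi : ℂ) * Complex.I * (α : ℂ)) * u (x₁, x₂)

/-- `u ∈ H^ℓ_α(Ω_R)`: `u ∈ H^ℓ(Ω_R)` is the restriction to `Ω_R` of an `α`-quasi-periodic
function in `H^ℓ_loc(ℝ²)`. -/
def MemHalpha (ℓ : ℕ) (α R : ℝ) (u : ℝ × ℝ → ℂ) : Prop :=
  MemH ℓ (cell R) u ∧ ∃ W : ℝ × ℝ → ℂ, IsQuasiPeriodic α W ∧ MemHloc ℓ W ∧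
    u =ᵐ[(volume : Measure (ℝ × ℝ)).restrict (cell R)] W

end QPVolumePotential

end

/-!
The Green's function and the density are expanded in the quasi-periodic modes `exp(i α_j x₁)`. The
`j`-th Fourier profile of `V_k f` in `x₂` is the convolution of the `j`-th profile of `f` with
`κ_j(t) = i / (4π β_j) exp(i β_j |t|)`. Both `|β_j|` and, up to a bounded shift, `Im β_j` grow like
`|α_j|`, so by the Young inequality this convolution gains two powers of `|α_j|`; the second
derivative in `x₂` adds to the convolution a multiple of the profile of `f` itself, from the jump of
`κ_j'` at the origin. The gain pays for the derivatives of order at most two, and by the Parseval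
identity the bounds on the profiles add up to `L²` bounds on each period.

The series of `G_{k,α}` converges only conditionally on the line `x₂ = 0`, but its terms have norms
of order `1 / |α_j|` with exponential decay in `|α_j| |x₂|`, so that integration in `x₂` makes their
`L²` norms summable. Hence the potential is the sum of its modes at every point, and its weak
derivatives may be computed mode by mode.
-/

namespace QPVolumePotential

/-! ### The square roots `β_j` -/

lemma betaj_sq (k : ℂ) (α : ℝ) (j : ℤ) : betaj k α j ^ 2 = k ^ 2 - (alphaj α j : ℂ) ^ 2 := by
  simpa only [betaj, one_div, Nat.cast_ofNat] using
    Complex.cpow_nat_inv_pow (k ^ 2 - (alphaj α j : ℂ) ^ 2) two_ne_zero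

lemma betaj_im_nonneg {k : ℂ} (hk : 0 ≤ (k ^ 2).im) (α : ℝ) (j : ℤ) : 0 ≤ (betaj k α j).im := by
  have him : 0 ≤ (k ^ 2 - (alphaj α j : ℂ) ^ 2).im := by
    rwa [← Complex.ofReal_pow, Complex.sub_im, Complex.ofReal_im, sub_zero]
  rw [betaj, one_div, Complex.cpow_inv_two_im_eq_sqrt him]
  exact Real.sqrt_nonneg _

/-- The standing assumptions on the wave number: `k²` lies in the closed upper half plane, so that
the principal roots `β_j` have nonnegative imaginary part, and no `β_j` vanishes. -/
structure Admissible (k : ℂ) (α : ℝ) : Prop where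
  sq_im_nonneg : 0 ≤ (k ^ 2).im
  sq_ne_alphaj_sq : ∀ j : ℤ, k ^ 2 ≠ (alphaj α j : ℂ) ^ 2

lemma Admissible.betaj_ne_zero {k : ℂ} {α : ℝ} (h : Admissible k α) (j : ℤ) :
    betaj k α j ≠ 0 := by
  rw [← pow_ne_zero_iff two_ne_zero, betaj_sq, sub_ne_zero]
  exact h.sq_ne_alphaj_sq j

/-- The frequency weight `1 + |α_j|`, comparable to `|β_j|`. -/
def weight (α : ℝ) (j : ℤ) : ℝ := 1 + |alphaj α j|

lemma one_le_weight (α : ℝ) (j : ℤ) : 1 ≤ weight α j := le_add_of_nonneg_right (abs_nonneg _)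

lemma weight_pos (α : ℝ) (j : ℤ) : 0 < weight α j := zero_lt_one.trans_le (one_le_weight α j)

lemma abs_alphaj_le_weight (α : ℝ) (j : ℤ) : |alphaj α j| ≤ weight α j :=
  le_add_of_nonneg_left zero_le_one

lemma tendsto_abs_alphaj (α : ℝ) :
    Filter.Tendsto (fun j : ℤ => |alphaj α j|) Filter.cofinite Filter.atTop :=
  tendsto_norm_cocompact_atTop.comp <|
    (Homeomorph.addRight α).isClosedEmbedding.tendsto_cocompact.comp Int.tendsto_coe_cofinite

lemma summable_weight_rpow (α : ℝ) {s : ℝ} (hs : 1 < s) :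
    Summable fun j : ℤ => weight α j ^ (-s) := by
  refine ((Real.summable_one_div_int_add_rpow α s).mpr hs).of_norm_bounded_eventually ?_
  filter_upwards [(tendsto_abs_alphaj α).eventually_ge_atTop 1] with j hj
  have : 0 < |(j : ℝ) + α| := zero_lt_one.trans_le hj
  have hw := weight_pos α j
  rw [Real.norm_of_nonneg (by positivity), Real.rpow_neg hw.le, ← one_div]
  gcongr
  exact abs_alphaj_le_weight α j

lemma norm_betaj_le (k : ℂ) (α : ℝ) (j : ℤ) : ‖betaj k α j‖ ≤ (‖k‖ + 1) * weight α j := by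
  refine le_of_sq_le_sq ?_ (by have := weight_pos α j; positivity)
  have hβ : ‖betaj k α j‖ ^ 2 ≤ ‖k‖ ^ 2 + |alphaj α j| ^ 2 := by
    rw [← norm_pow, betaj_sq]
    exact (norm_sub_le _ _).trans_eq (by
      simp only [norm_pow, Complex.norm_real, Real.norm_eq_abs])
  rw [weight]
  nlinarith [norm_nonneg k, abs_nonneg (alphaj α j),
    mul_nonneg (norm_nonneg k) (abs_nonneg (alphaj α j))]

lemma abs_alphaj_sub_norm_le_im_betaj {k : ℂ} (hk : 0 ≤ (k ^ 2).im) (α : ℝ) (j : ℤ) :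
    |alphaj α j| - ‖k‖ ≤ (betaj k α j).im := by
  by_contra! h
  have hre : (betaj k α j).re ^ 2 - (betaj k α j).im ^ 2 = (k ^ 2).re - alphaj α j ^ 2 := by
    have := congrArg Complex.re (betaj_sq k α j)
    rwa [← Complex.ofReal_pow, Complex.sub_re, Complex.ofReal_re, pow_two, Complex.mul_re,
      ← pow_two, ← pow_two] at this
  have hk2 : (k ^ 2).re ≤ ‖k‖ ^ 2 := (Complex.re_le_norm _).trans_eq (norm_pow k 2)
  have him : (betaj k α j).im ^ 2 < (|alphaj α j| - ‖k‖) ^ 2 := by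
    have := betaj_im_nonneg hk α j
    gcongr
  nlinarith [norm_nonneg k, sq_nonneg (betaj k α j).re, sq_abs (alphaj α j),
    betaj_im_nonneg hk α j]

lemma Admissible.exists_weight_le_norm_betaj {k : ℂ} {α : ℝ} (h : Admissible k α) :
    ∃ C : ℝ, 0 ≤ C ∧ ∀ j : ℤ, weight α j ≤ C * ‖betaj k α j‖ := by
  have hbdd : Filter.IsBoundedUnder (· ≤ ·) Filter.cofinite
      fun j : ℤ => weight α j / ‖betaj k α j‖ := by
    refine Filter.isBoundedUnder_of_eventually_le (a := 4) ?_
    filter_upwards [(tendsto_abs_alphaj α).eventually_ge_atTop (2 * ‖k‖ + 1)] with j hj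
    rw [div_le_iff₀ (norm_pos_iff.mpr (h.betaj_ne_zero j)), weight]
    linarith [abs_alphaj_sub_norm_le_im_betaj h.sq_im_nonneg α j, norm_nonneg k,
      (le_abs_self _).trans (Complex.abs_im_le_norm (betaj k α j))]
  obtain ⟨C, hC⟩ := hbdd.bddAbove_range_of_cofinite
  refine ⟨max C 0, le_max_right _ _, fun j => ?_⟩
  rw [← div_le_iff₀ (norm_pos_iff.mpr (h.betaj_ne_zero j))]
  exact (hC ⟨j, rfl⟩).trans (le_max_left _ _)

/-! ### Convolution estimates -/

lemma lintegral_exp_neg_mul_abs {a : ℝ} (ha : 0 < a) :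
    ∫⁻ t : ℝ, ENNReal.ofReal (Real.exp (-(a * |t|))) = ENNReal.ofReal (2 / a) := by
  have h : ∫ t : ℝ, Real.exp (-(a * |t|)) = 2 / a := by
    rw [integral_comp_abs (f := fun t => Real.exp (-(a * t)))]
    simp only [← neg_mul]
    rw [integral_exp_mul_Ioi (neg_lt_zero.mpr ha) 0, mul_zero, Real.exp_zero, neg_div_neg_eq,
      mul_one_div]
  have hi : Integrable fun t : ℝ => Real.exp (-(a * |t|)) := by
    by_contra hn
    rw [integral_undef hn] at h
    exact (by positivity : 2 / a ≠ 0) h.symm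
  rw [← ofReal_integral_eq_lintegral_ofReal hi (.of_forall fun t => (Real.exp_pos _).le), h]

lemma sq_lintegral_mul_le {X : Type*} [MeasurableSpace X] {μ : Measure X} {f g : X → ℝ≥0∞}
    (hf : AEMeasurable f μ) (hg : AEMeasurable g μ) :
    (∫⁻ x, f x * g x ∂μ) ^ 2 ≤ (∫⁻ x, f x ∂μ) * ∫⁻ x, f x * g x ^ 2 ∂μ := by
  have sq_sqrt (a : ℝ≥0∞) : (a ^ (1 / 2 : ℝ)) ^ 2 = a := by
    rw [← ENNReal.rpow_natCast, ← ENNReal.rpow_mul]; norm_num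
  have holder := ENNReal.lintegral_mul_le_Lp_mul_Lq μ Real.HolderConjugate.two_two
    (f := fun x => f x ^ (1 / 2 : ℝ)) (g := fun x => f x ^ (1 / 2 : ℝ) * g x)
    (by fun_prop) (by fun_prop)
  simp only [Pi.mul_apply, ← mul_assoc, ← pow_two, ENNReal.rpow_two, mul_pow, sq_sqrt] at holder
  calc (∫⁻ x, f x * g x ∂μ) ^ 2
      ≤ ((∫⁻ x, f x ∂μ) ^ (1 / 2 : ℝ) * (∫⁻ x, f x * g x ^ 2 ∂μ) ^ (1 / 2 : ℝ)) ^ 2 := by gcongr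
    _ = (∫⁻ x, f x ∂μ) * ∫⁻ x, f x * g x ^ 2 ∂μ := by rw [mul_pow, sq_sqrt, sq_sqrt]

lemma lintegral_sq_lintegral_sub_mul_le {G : Type*} [AddCommGroup G] [MeasurableSpace G]
    [MeasurableAdd₂ G] [MeasurableNeg G] {μ : Measure G} [SFinite μ] [μ.IsAddLeftInvariant]
    [μ.IsNegInvariant] {κ h : G → ℝ≥0∞} (hκ : Measurable κ) (hh : Measurable h) :
    ∫⁻ x, (∫⁻ y, κ (x - y) * h y ∂μ) ^ 2 ∂μ ≤ (∫⁻ t, κ t ∂μ) ^ 2 * ∫⁻ y, h y ^ 2 ∂μ := by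
  calc ∫⁻ x, (∫⁻ y, κ (x - y) * h y ∂μ) ^ 2 ∂μ
      ≤ ∫⁻ x, (∫⁻ t, κ t ∂μ) * ∫⁻ y, κ (x - y) * h y ^ 2 ∂μ ∂μ := by
        refine lintegral_mono fun x => ?_
        refine (sq_lintegral_mul_le (by fun_prop) hh.aemeasurable).trans_eq ?_
        rw [lintegral_sub_left_eq_self κ x]
    _ = (∫⁻ t, κ t ∂μ) * ∫⁻ y, ∫⁻ x, κ (x - y) * h y ^ 2 ∂μ ∂μ := by
        rw [lintegral_const_mul _ (by fun_prop), lintegral_lintegral_swap (by fun_prop)]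
    _ = (∫⁻ t, κ t ∂μ) * ∫⁻ y, (∫⁻ t, κ t ∂μ) * h y ^ 2 ∂μ := by
        congr 1
        refine lintegral_congr fun y => ?_
        rw [lintegral_mul_const _ (by fun_prop), lintegral_sub_right_eq_self κ y]
    _ = (∫⁻ t, κ t ∂μ) ^ 2 * ∫⁻ y, h y ^ 2 ∂μ := by
        rw [lintegral_const_mul _ (by fun_prop), pow_two, mul_assoc]

lemma setLIntegral_enorm_sq_conv_le {κ h : ℝ → ℂ} {A a R ρ : ℝ} (ha : 0 < a) (hA : 0 ≤ A)
    (hh : Measurable h) (hsupp : ∀ y, ρ ≤ |y| → h y = 0)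
    (hκ : ∀ t, |t| ≤ R + ρ → ‖κ t‖ ≤ A * Real.exp (-(a * |t|))) :
    ∫⁻ x in Set.Ioo (-R) R, ‖∫ y, κ (x - y) * h y‖ₑ ^ 2
      ≤ ENNReal.ofReal (2 * A / a) ^ 2 * ∫⁻ y, ‖h y‖ₑ ^ 2 := by
  set K : ℝ → ℝ≥0∞ := fun t => ENNReal.ofReal (A * Real.exp (-(a * |t|))) with hK
  have hKm : Measurable K := by fun_prop
  have integral_K : ∫⁻ t, K t = ENNReal.ofReal (2 * A / a) := by
    simp only [hK, ENNReal.ofReal_mul hA]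
    rw [lintegral_const_mul _ (by fun_prop), lintegral_exp_neg_mul_abs ha,
      ← ENNReal.ofReal_mul hA, mul_div_left_comm, mul_div_assoc]
  have norm_le_K (x : ℝ) (hx : |x| < R) (y : ℝ) : ‖κ (x - y) * h y‖ₑ ≤ K (x - y) * ‖h y‖ₑ := by
    rcases le_or_gt ρ |y| with hy | hy
    · simp [hsupp y hy]
    · rw [enorm_mul, ← ofReal_norm (κ (x - y))]
      gcongr
      exact ENNReal.ofReal_le_ofReal (hκ _ ((abs_sub x y).trans (add_le_add hx.le hy.le)))
  calc ∫⁻ x in Set.Ioo (-R) R, ‖∫ y, κ (x - y) * h y‖ₑ ^ 2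
      ≤ ∫⁻ x in Set.Ioo (-R) R, (∫⁻ y, K (x - y) * ‖h y‖ₑ) ^ 2 := by
        refine setLIntegral_mono (by fun_prop) fun x hx => ?_
        gcongr
        exact (enorm_integral_le_lintegral_enorm _).trans
          (lintegral_mono (norm_le_K x (abs_lt.mpr hx)))
    _ ≤ ∫⁻ x, (∫⁻ y, K (x - y) * ‖h y‖ₑ) ^ 2 := setLIntegral_le_lintegral _ _
    _ ≤ (∫⁻ t, K t) ^ 2 * ∫⁻ y, ‖h y‖ₑ ^ 2 :=
        lintegral_sq_lintegral_sub_mul_le hKm (by fun_prop)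
    _ = ENNReal.ofReal (2 * A / a) ^ 2 * ∫⁻ y, ‖h y‖ₑ ^ 2 := by rw [integral_K]

/-! ### Weak derivatives on the line -/

/-- The distributional derivative of `h` on the line is `h' + c δ₀`. The point mass records the
jump of `h` at the origin. -/
structure HasWeakDerivLine (h h' : ℝ → ℂ) (c : ℂ) : Prop where
  locallyIntegrable : LocallyIntegrable h
  locallyIntegrable_deriv : LocallyIntegrable h'
  integral_mul_deriv : ∀ ψ : ℝ → ℂ, ContDiff ℝ 1 ψ → HasCompactSupport ψ →
    ∫ x, h x * deriv ψ x = -(c * ψ 0) - ∫ x, h' x * ψ x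

lemma HasWeakDerivLine.of_hasDerivAt {h h' : ℝ → ℂ} {p q : ℂ} (hh : LocallyIntegrable h)
    (hh' : LocallyIntegrable h') (hd : ∀ t ≠ 0, HasDerivAt h (h' t) t)
    (hp : Filter.Tendsto h (nhdsWithin 0 (Set.Ioi 0)) (nhds p))
    (hq : Filter.Tendsto h (nhdsWithin 0 (Set.Iio 0)) (nhds q)) :
    HasWeakDerivLine h h' (p - q) := by
  refine ⟨hh, hh', fun ψ hψ hc => ?_⟩
  have hdψ (t : ℝ) : HasDerivAt ψ (deriv ψ t) t := (hψ.differentiable one_ne_zero t).hasDerivAt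
  have iu : Integrable fun t => h t * deriv ψ t :=
    hh.integrable_smul_right_of_hasCompactSupport (hψ.continuous_deriv le_rfl) hc.deriv
  have iv : Integrable fun t => h' t * ψ t :=
    hh'.integrable_smul_right_of_hasCompactSupport hψ.continuous hc
  have vanish {l : Filter ℝ} (hl : l ≤ Filter.cocompact ℝ) :
      Filter.Tendsto (h * ψ) l (nhds 0) := by
    refine tendsto_const_nhds.congr' (Filter.Eventually.filter_mono hl ?_)
    filter_upwards [hc.isCompact.compl_mem_cocompact] with t ht
    simp [image_eq_zero_of_notMem_tsupport ht]
  have hψ0 (s : Set ℝ) : Filter.Tendsto ψ (nhdsWithin 0 s) (nhds (ψ 0)) :=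
    hψ.continuous.continuousWithinAt
  have right := integral_Ioi_mul_deriv_eq_deriv_mul (fun t (ht : 0 < t) => hd t ht.ne')
    (fun t _ => hdψ t) iu.integrableOn iv.integrableOn (hp.mul (hψ0 _))
    (vanish atTop_le_cocompact)
  have left := integral_Iic_mul_deriv_eq_deriv_mul (fun t (ht : t < 0) => hd t ht.ne)
    (fun t _ => hdψ t) iu.integrableOn iv.integrableOn (hq.mul (hψ0 _))
    (vanish atBot_le_cocompact)
  rw [← intervalIntegral.integral_Iic_add_Ioi iu.integrableOn iu.integrableOn (b := 0),
    ← intervalIntegral.integral_Iic_add_Ioi iv.integrableOn iv.integrableOn (b := 0), right, left]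
  ring

lemma HasWeakDerivLine.integral_comp_sub_mul_deriv {κ κ' ψ : ℝ → ℂ} {c : ℂ}
    (hκ : HasWeakDerivLine κ κ' c) (hψ : ContDiff ℝ 1 ψ) (hc : HasCompactSupport ψ) (y : ℝ) :
    ∫ x, κ (x - y) * deriv ψ x = -(c * ψ y) - ∫ x, κ' (x - y) * ψ x := by
  have key := hκ.integral_mul_deriv (fun x => ψ (x + y)) (hψ.comp (by fun_prop))
    (hc.comp_homeomorph (Homeomorph.addRight y))
  simp only [deriv_comp_add_const, zero_add] at key
  rw [← integral_sub_right_eq_self (fun x => κ x * deriv ψ (x + y)) y,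
    ← integral_sub_right_eq_self (fun x => κ' x * ψ (x + y)) y] at key
  simpa only [sub_add_cancel] using key

lemma integrable_prod_comp_sub_mul_mul {G : Type*} [AddGroup G] [MeasurableSpace G]
    [MeasurableSub₂ G] {μ : Measure G} {𝕜 : Type*} [RCLike 𝕜] {κ h χ : G → 𝕜} {B : ℝ}
    (hκ : Measurable κ) (hB : ∀ t, ‖κ t‖ ≤ B) (hh : Integrable h μ) (hχ : Integrable χ μ) :
    Integrable (fun z : G × G => κ (z.1 - z.2) * h z.2 * χ z.1) (μ.prod μ) := by
  simp only [mul_assoc, mul_comm (h _)]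
  exact (hχ.mul_prod hh).bdd_mul (c := B) (hκ.comp measurable_sub).aestronglyMeasurable
    (.of_forall fun z => hB _)

lemma integral_conv_mul {G : Type*} [AddGroup G] [MeasurableSpace G]
    [MeasurableSub₂ G] {μ : Measure G} [SFinite μ] {𝕜 : Type*}
    [RCLike 𝕜] {κ h χ : G → 𝕜} {B : ℝ} (hκ : Measurable κ)
    (hB : ∀ t, ‖κ t‖ ≤ B) (hh : Integrable h μ) (hχ : Integrable χ μ) :
    ∫ x, (∫ y, κ (x - y) * h y ∂μ) * χ x ∂μ = ∫ y, h y * ∫ x, κ (x - y) * χ x ∂μ ∂μ := by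
  simp only [← integral_mul_const, ← integral_const_mul]
  rw [integral_integral_swap (integrable_prod_comp_sub_mul_mul hκ hB hh hχ)]
  simp only [mul_left_comm (h _), mul_assoc]

lemma locallyIntegrable_conv {κ h : ℝ → ℂ} {B : ℝ} (hκ : Measurable κ) (hB : ∀ t, ‖κ t‖ ≤ B)
    (hh : Integrable h) : LocallyIntegrable fun x => ∫ y, κ (x - y) * h y := by
  refine (locallyIntegrable_const (B * ∫ y, ‖h y‖)).mono ?_ (.of_forall fun x => ?_)
  · have hm : AEStronglyMeasurable (fun z : ℝ × ℝ => κ (z.1 - z.2) * h z.2) (volume.prod volume) :=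
      (hκ.comp measurable_sub).aestronglyMeasurable.mul hh.aestronglyMeasurable.comp_snd
    exact hm.integral_prod_right'
  · rw [← integral_const_mul]
    refine (norm_integral_le_of_norm_le (hh.norm.const_mul B) (.of_forall fun y => ?_)).trans
      (le_abs_self _)
    rw [norm_mul]
    gcongr
    exact hB _

lemma HasWeakDerivLine.conv {κ κ' h : ℝ → ℂ} {c : ℂ} (hκ : HasWeakDerivLine κ κ' c)
    (hm : Measurable κ) (hm' : Measurable κ') {B B' : ℝ} (hB : ∀ t, ‖κ t‖ ≤ B)
    (hB' : ∀ t, ‖κ' t‖ ≤ B') (hh : Integrable h) :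
    HasWeakDerivLine (fun x => ∫ y, κ (x - y) * h y)
      (fun x => (∫ y, κ' (x - y) * h y) + c * h x) 0 := by
  have hconv' := locallyIntegrable_conv hm' hB' hh
  refine ⟨locallyIntegrable_conv hm hB hh, hconv'.add (hh.const_mul c).locallyIntegrable,
    fun ψ hψ hc => ?_⟩
  have iψ : Integrable ψ := hψ.continuous.integrable_of_hasCompactSupport hc
  have ihψ : Integrable fun y => h y * (-(c * ψ y)) := by
    simpa only [smul_eq_mul] using hh.locallyIntegrable.integrable_smul_right_of_hasCompactSupport
      (g := fun y => -(c * ψ y)) (by fun_prop) hc.mul_left.neg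
  have iκ' : Integrable fun y => h y * ∫ x, κ' (x - y) * ψ x := by
    have := (integrable_prod_comp_sub_mul_mul hm' hB' hh iψ).integral_prod_right
    simpa only [← integral_const_mul, mul_left_comm (h _), mul_assoc] using this
  have iconv' : Integrable fun x => (∫ y, κ' (x - y) * h y) * ψ x :=
    hconv'.integrable_smul_right_of_hasCompactSupport hψ.continuous hc
  calc ∫ x, (∫ y, κ (x - y) * h y) * deriv ψ x
      = ∫ y, h y * ∫ x, κ (x - y) * deriv ψ x :=
        integral_conv_mul hm hB hh
          ((hψ.continuous_deriv le_rfl).integrable_of_hasCompactSupport hc.deriv)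
    _ = (∫ y, h y * (-(c * ψ y))) - ∫ y, h y * ∫ x, κ' (x - y) * ψ x := by
        simp only [hκ.integral_comp_sub_mul_deriv hψ hc, mul_sub]
        exact integral_sub ihψ iκ'
    _ = -(0 * ψ 0) - ((∫ x, (∫ y, κ' (x - y) * h y) * ψ x) - ∫ y, h y * (-(c * ψ y))) := by
        rw [integral_conv_mul hm' hB' hh iψ]; ring
    _ = -(0 * ψ 0) - ∫ x, ((∫ y, κ' (x - y) * h y) + c * h x) * ψ x := by
        rw [← integral_sub iconv' ihψ]
        congr 2 with x
        ring

/-! ### The one-dimensional fundamental solutions -/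

/-- The `n`-th derivative, away from the origin, of the fundamental solution
`t ↦ i / (4π β_j) exp(i β_j |t|)` of `u'' + β_j² u = -(2π)⁻¹ δ₀`. The value at the origin is the
limit from the left. -/
noncomputable def modeKernel (k : ℂ) (α : ℝ) (j : ℤ) (n : ℕ) (t : ℝ) : ℂ :=
  Complex.I / (4 * (Real.pi : ℂ) * betaj k α j) *
    (if 0 < t then Complex.I * betaj k α j else -(Complex.I * betaj k α j)) ^ n *
    Complex.exp (Complex.I * betaj k α j * ((|t| : ℝ) : ℂ))

lemma measurable_modeKernel (k : ℂ) (α : ℝ) (j : ℤ) (n : ℕ) : Measurable (modeKernel k α j n) :=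
  (measurable_const.mul ((Measurable.ite measurableSet_Ioi measurable_const
    measurable_const).pow_const n)).mul (by fun_prop)

lemma norm_modeKernel (k : ℂ) (α : ℝ) (j : ℤ) (n : ℕ) (t : ℝ) :
    ‖modeKernel k α j n t‖
      = ‖betaj k α j‖ ^ n / (4 * Real.pi * ‖betaj k α j‖)
        * Real.exp (-((betaj k α j).im * |t|)) := by
  have norm_root : ‖if 0 < t then Complex.I * betaj k α j else -(Complex.I * betaj k α j)‖
      = ‖betaj k α j‖ := by
    split_ifs <;> simp only [norm_neg, norm_mul, Complex.norm_I, one_mul]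
  have re_exponent : (Complex.I * betaj k α j * ((|t| : ℝ) : ℂ)).re
      = -((betaj k α j).im * |t|) := by
    simp only [Complex.re_mul_ofReal, Complex.I_mul_re, neg_mul]
  simp only [modeKernel, norm_mul, norm_pow, norm_root, norm_div, Complex.norm_I,
    Complex.norm_real, Real.norm_of_nonneg Real.pi_pos.le, Complex.norm_ofNat, Complex.norm_exp,
    re_exponent]
  ring

lemma norm_modeKernel_le {k : ℂ} (hk : 0 ≤ (k ^ 2).im) (α : ℝ) (j : ℤ) (n : ℕ) (t : ℝ) :
    ‖modeKernel k α j n t‖ ≤ ‖betaj k α j‖ ^ n / (4 * Real.pi * ‖betaj k α j‖) := by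
  rw [norm_modeKernel]
  refine mul_le_of_le_one_right (by positivity) (Real.exp_le_one_iff.mpr ?_)
  exact neg_nonpos.mpr (mul_nonneg (betaj_im_nonneg hk α j) (abs_nonneg t))

lemma exp_neg_im_betaj_mul_abs_le {k : ℂ} (hk : 0 ≤ (k ^ 2).im) (α : ℝ) (j : ℤ) {t T : ℝ}
    (ht : |t| ≤ T) :
    Real.exp (-((betaj k α j).im * |t|))
      ≤ Real.exp ((1 + ‖k‖) * T) * Real.exp (-(weight α j * |t|)) := by
  rw [← Real.exp_add, Real.exp_le_exp, weight]
  have hT : (1 + ‖k‖) * |t| ≤ (1 + ‖k‖) * T := by gcongr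
  have hβ : (|alphaj α j| - ‖k‖) * |t| ≤ (betaj k α j).im * |t| := by
    gcongr
    exact abs_alphaj_sub_norm_le_im_betaj hk α j
  linarith

lemma Admissible.exists_norm_modeKernel_le {k : ℂ} {α : ℝ} (h : Admissible k α) (n : ℕ) (T : ℝ) :
    ∃ A : ℝ, 0 ≤ A ∧ ∀ (j : ℤ) (t : ℝ), |t| ≤ T →
      ‖modeKernel k α j n t‖
        ≤ A * weight α j ^ n / weight α j * Real.exp (-(weight α j * |t|)) := by
  obtain ⟨C, hC0, hC⟩ := h.exists_weight_le_norm_betaj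
  refine ⟨(‖k‖ + 1) ^ n * C * Real.exp ((1 + ‖k‖) * T), by positivity, fun j t ht => ?_⟩
  have hβ : 0 < ‖betaj k α j‖ := norm_pos_iff.mpr (h.betaj_ne_zero j)
  have hw := weight_pos α j
  have hpow : ‖betaj k α j‖ ^ n ≤ (‖k‖ + 1) ^ n * weight α j ^ n := by
    rw [← mul_pow]
    exact pow_le_pow_left₀ hβ.le (norm_betaj_le k α j) n
  have hinv : (4 * Real.pi * ‖betaj k α j‖)⁻¹ ≤ C / weight α j := by
    rw [inv_le_iff_one_le_mul₀ (by positivity), div_mul_eq_mul_div, one_le_div hw]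
    nlinarith [hC j, Real.pi_gt_three, mul_nonneg hC0 hβ.le]
  rw [norm_modeKernel, div_eq_mul_inv]
  calc ‖betaj k α j‖ ^ n * (4 * Real.pi * ‖betaj k α j‖)⁻¹ * Real.exp (-((betaj k α j).im * |t|))
      ≤ (‖k‖ + 1) ^ n * weight α j ^ n * (C / weight α j) *
          (Real.exp ((1 + ‖k‖) * T) * Real.exp (-(weight α j * |t|))) := by
        gcongr
        exact exp_neg_im_betaj_mul_abs_le h.sq_im_nonneg α j ht
    _ = _ := by ring

lemma modeKernel_of_pos (k : ℂ) (α : ℝ) (j : ℤ) (n : ℕ) {t : ℝ} (ht : 0 < t) :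
    modeKernel k α j n t = Complex.I / (4 * (Real.pi : ℂ) * betaj k α j) *
      (Complex.I * betaj k α j) ^ n * Complex.exp (Complex.I * betaj k α j * (t : ℂ)) := by
  rw [modeKernel, if_pos ht, abs_of_pos ht]

lemma modeKernel_of_neg (k : ℂ) (α : ℝ) (j : ℤ) (n : ℕ) {t : ℝ} (ht : t < 0) :
    modeKernel k α j n t = Complex.I / (4 * (Real.pi : ℂ) * betaj k α j) *
      (-(Complex.I * betaj k α j)) ^ n * Complex.exp (-(Complex.I * betaj k α j) * (t : ℂ)) := by
  rw [modeKernel, if_neg ht.not_gt, abs_of_neg ht, Complex.ofReal_neg, mul_neg, neg_mul]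

lemma hasDerivAt_modeKernel (k : ℂ) (α : ℝ) (j : ℤ) (n : ℕ) {t : ℝ} (ht : t ≠ 0) :
    HasDerivAt (modeKernel k α j n) (modeKernel k α j (n + 1) t) t := by
  have hexp (c b : ℂ) : HasDerivAt (fun s : ℝ => c * b ^ n * Complex.exp (b * (s : ℂ)))
      (c * b ^ (n + 1) * Complex.exp (b * (t : ℂ))) t := by
    refine (((Complex.ofRealCLM.hasDerivAt (x := t)).const_mul b).cexp.const_mul
      (c * b ^ n)).congr_deriv ?_
    simp only [Complex.ofRealCLM_apply, Complex.ofReal_one]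
    ring
  rcases ht.lt_or_gt with ht | ht
  · rw [modeKernel_of_neg k α j _ ht]
    refine (hexp _ _).congr_of_eventuallyEq ?_
    filter_upwards [gt_mem_nhds ht] with s hs using modeKernel_of_neg k α j n hs
  · rw [modeKernel_of_pos k α j _ ht]
    refine (hexp _ _).congr_of_eventuallyEq ?_
    filter_upwards [lt_mem_nhds ht] with s hs using modeKernel_of_pos k α j n hs

lemma locallyIntegrable_modeKernel {k : ℂ} (hk : 0 ≤ (k ^ 2).im) (α : ℝ) (j : ℤ) (n : ℕ) :
    LocallyIntegrable (modeKernel k α j n) :=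
  (locallyIntegrable_const (‖betaj k α j‖ ^ n / (4 * Real.pi * ‖betaj k α j‖))).mono
    (measurable_modeKernel k α j n).aestronglyMeasurable
    (.of_forall fun t => (norm_modeKernel_le hk α j n t).trans (le_abs_self _))

lemma hasWeakDerivLine_modeKernel {k : ℂ} (hk : 0 ≤ (k ^ 2).im) (α : ℝ) (j : ℤ) (n : ℕ) :
    HasWeakDerivLine (modeKernel k α j n) (modeKernel k α j (n + 1))
      (Complex.I / (4 * (Real.pi : ℂ) * betaj k α j) * (Complex.I * betaj k α j) ^ n
        - Complex.I / (4 * (Real.pi : ℂ) * betaj k α j) * (-(Complex.I * betaj k α j)) ^ n) := by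
  have lim (c b : ℂ) (s : Set ℝ) :
      Filter.Tendsto (fun t : ℝ => c * Complex.exp (b * (t : ℂ))) (nhdsWithin 0 s) (nhds c) := by
    have hcont : Continuous fun t : ℝ => c * Complex.exp (b * (t : ℂ)) := by fun_prop
    simpa using (hcont.tendsto 0).mono_left nhdsWithin_le_nhds
  refine .of_hasDerivAt (locallyIntegrable_modeKernel hk α j n)
    (locallyIntegrable_modeKernel hk α j (n + 1)) (fun t ht => hasDerivAt_modeKernel k α j n ht)
    ((lim _ (Complex.I * betaj k α j) _).congr' ?_)
    ((lim _ (-(Complex.I * betaj k α j)) _).congr' ?_)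
  · filter_upwards [self_mem_nhdsWithin] with t ht using (modeKernel_of_pos k α j n ht).symm
  · filter_upwards [self_mem_nhdsWithin] with t ht using (modeKernel_of_neg k α j n ht).symm

/-! ### Fourier coefficients of a density -/

/-- The exponential `x ↦ exp(i a x)` of frequency `a`. -/
noncomputable def planeWave (a x : ℝ) : ℂ := Complex.exp (Complex.I * (a : ℂ) * (x : ℂ))

@[fun_prop]
lemma continuous_planeWave (a : ℝ) : Continuous (planeWave a) := by
  unfold planeWave
  fun_prop

@[simp]
lemma norm_planeWave (a x : ℝ) : ‖planeWave a x‖ = 1 := by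
  rw [planeWave, mul_assoc, mul_comm, ← Complex.ofReal_mul, Complex.norm_exp_ofReal_mul_I]

@[simp]
lemma enorm_planeWave (a x : ℝ) : ‖planeWave a x‖ₑ = 1 := by
  rw [← ofReal_norm, norm_planeWave, ENNReal.ofReal_one]

lemma planeWave_sub (a x y : ℝ) : planeWave a (x - y) = planeWave a x * planeWave (-a) y := by
  simp only [planeWave, ← Complex.exp_add]
  push_cast
  ring_nf

lemma hasDerivAt_planeWave (a x : ℝ) :
    HasDerivAt (planeWave a) (Complex.I * (a : ℂ) * planeWave a x) x := by
  refine ((Complex.ofRealCLM.hasDerivAt (x := x)).const_mul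
    (Complex.I * (a : ℂ))).cexp.congr_deriv ?_
  simp only [Complex.ofRealCLM_apply, Complex.ofReal_one, planeWave]
  ring

/-- The rectangle `(-mπ, mπ) × (-R, R)`, which spans `m` periods of a quasi-periodic function. -/
def box (m : ℕ) (R : ℝ) : Set (ℝ × ℝ) :=
  Set.Ioo (-(m * Real.pi)) (m * Real.pi) ×ˢ Set.Ioo (-R) R

lemma box_one (R : ℝ) : box 1 R = cell R := by
  rw [box, cell, Nat.cast_one, one_mul]

lemma isOpen_box (m : ℕ) (R : ℝ) : IsOpen (box m R) := isOpen_Ioo.prod isOpen_Ioo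

lemma volume_box_lt_top (m : ℕ) (R : ℝ) : volume (box m R) < ⊤ :=
  ((Metric.isBounded_Ioo _ _).prod (Metric.isBounded_Ioo _ _)).measure_lt_top

lemma exists_subset_box {s : Set (ℝ × ℝ)} (hs : Bornology.IsBounded s) :
    ∃ (m : ℕ) (R : ℝ), s ⊆ box m R := by
  obtain ⟨r, hr⟩ := hs.subset_ball 0
  obtain ⟨m, hm⟩ := exists_nat_ge r
  refine ⟨m, r, fun x hx => ?_⟩
  have hx' := hr hx
  rw [← ball_prod_same, Set.mem_prod, Real.ball_eq_Ioo, Real.ball_eq_Ioo] at hx'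
  have hmπ : r ≤ m * Real.pi :=
    hm.trans (le_mul_of_one_le_right m.cast_nonneg (by linarith [Real.pi_gt_three]))
  simp only [zero_sub, zero_add, Prod.fst_zero, Prod.snd_zero] at hx'
  exact ⟨Set.Ioo_subset_Ioo (neg_le_neg hmπ) hmπ hx'.1, hx'.2⟩

lemma eLpNorm_two_sq {X E : Type*} [MeasurableSpace X] [NormedAddCommGroup E] (μ : Measure X)
    (f : X → E) : eLpNorm f 2 μ ^ 2 = ∫⁻ x, ‖f x‖ₑ ^ 2 ∂μ := by
  simpa using eLpNorm_nnreal_pow_eq_lintegral (f := f) (μ := μ) (p := 2) two_ne_zero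

lemma memLp_two_of_lintegral_enorm_sq_lt_top {X E : Type*} [MeasurableSpace X]
    [NormedAddCommGroup E] {μ : Measure X} {f : X → E} (hf : AEStronglyMeasurable f μ)
    (h : ∫⁻ x, ‖f x‖ₑ ^ 2 ∂μ < ⊤) : MemLp f 2 μ :=
  ⟨hf, by rwa [← eLpNorm_two_sq, ENNReal.pow_lt_top_iff, or_iff_left two_ne_zero] at h⟩

/-- A square integrable density on the plane that vanishes outside `box m ρ`. -/
structure IsDensity (m : ℕ) (ρ : ℝ) (F : ℝ × ℝ → ℂ) : Prop where
  measurable : Measurable F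
  eq_zero : ∀ y, y ∉ box m ρ → F y = 0
  memLp : MemLp F 2

lemma IsDensity.integrable {m : ℕ} {ρ : ℝ} {F : ℝ × ℝ → ℂ} (hF : IsDensity m ρ F) :
    Integrable F := by
  have : IsFiniteMeasure (volume.restrict (box m ρ)) :=
    isFiniteMeasure_restrict.mpr (volume_box_lt_top m ρ).ne
  have hbox : IntegrableOn F (box m ρ) := (hF.memLp.restrict _).integrable one_le_two
  exact hbox.integrable_of_forall_notMem_eq_zero hF.eq_zero

/-- The quasi-periodic Fourier coefficient `∫ exp(-i α_j y₁) F(y₁, y₂) dy₁`. -/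
noncomputable def coeff (α : ℝ) (F : ℝ × ℝ → ℂ) (j : ℤ) (y₂ : ℝ) : ℂ :=
  ∫ y₁ : ℝ, planeWave (-alphaj α j) y₁ * F (y₁, y₂)

namespace IsDensity

variable {m : ℕ} {ρ : ℝ} {F : ℝ × ℝ → ℂ}

lemma coeff_eq_zero (hF : IsDensity m ρ F) (α : ℝ) (j : ℤ) {y₂ : ℝ} (hy : ρ ≤ |y₂|) :
    coeff α F j y₂ = 0 := by
  have (y₁ : ℝ) : F (y₁, y₂) = 0 := hF.eq_zero _ fun h => (abs_lt.mpr h.2).not_ge hy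
  simp only [coeff, this, mul_zero, integral_zero]

lemma measurable_coeff (hF : IsDensity m ρ F) (α : ℝ) (j : ℤ) : Measurable (coeff α F j) := by
  have := hF.measurable
  have hm : Measurable fun y : ℝ × ℝ => planeWave (-alphaj α j) y.1 * F y := by fun_prop
  exact hm.stronglyMeasurable.integral_prod_left'.measurable

lemma integrable_planeWave_mul (hF : IsDensity m ρ F) (a : ℝ) :
    Integrable fun y : ℝ × ℝ => planeWave a y.1 * F y :=
  hF.integrable.bdd_mul (c := 1) (by fun_prop) (.of_forall fun y => (norm_planeWave a y.1).le)

lemma integrable_coeff (hF : IsDensity m ρ F) (α : ℝ) (j : ℤ) : Integrable (coeff α F j) :=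
  (hF.integrable_planeWave_mul (-alphaj α j)).integral_prod_right

end IsDensity

lemma tsum_enorm_sq_fourierCoeffOn {a b : ℝ} (hab : a < b) {g : ℝ → ℂ}
    (hg : MemLp g 2 (volume.restrict (Set.Ioc a b))) :
    ∑' n : ℤ, ‖fourierCoeffOn hab g n‖ₑ ^ 2
      = ENNReal.ofReal (b - a)⁻¹ * ∫⁻ x in Set.Ioc a b, ‖g x‖ₑ ^ 2 := by
  have parseval := hasSum_sq_fourierCoeffOn hab hg
  have hnorm (z : ℂ) : ENNReal.ofReal (‖z‖ ^ 2) = ‖z‖ₑ ^ 2 := by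
    rw [ENNReal.ofReal_pow (norm_nonneg _), ofReal_norm]
  have key := ENNReal.ofReal_tsum_of_nonneg (fun n => sq_nonneg _) parseval.summable
  rw [parseval.tsum_eq, smul_eq_mul, ENNReal.ofReal_mul (inv_nonneg.mpr (sub_pos.mpr hab).le),
    intervalIntegral.integral_of_le hab.le,
    ofReal_integral_eq_lintegral_ofReal (hg.integrable_norm_pow two_ne_zero)
      (.of_forall fun x => sq_nonneg _)] at key
  simpa only [hnorm] using key.symm

lemma integral_planeWave_mul_eq_fourierCoeffOn (α : ℝ) {m : ℕ}
    (hab : -(m * Real.pi) < m * Real.pi) (h : ℝ → ℂ) (j : ℤ) :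
    ∫ y in Set.Ioc (-(m * Real.pi)) (m * Real.pi), planeWave (-alphaj α j) y * h y
      = (2 * (m * Real.pi) : ℝ) •
        fourierCoeffOn hab (fun y => planeWave (-α) y * h y) (m * j) := by
  have hmπ : 0 < m * Real.pi := by linarith
  have hm : (m : ℂ) ≠ 0 := by
    rintro hm
    rw [Nat.cast_eq_zero.mp hm] at hmπ
    simp at hmπ
  have hπ : (Real.pi : ℂ) ≠ 0 := by exact_mod_cast Real.pi_ne_zero
  rw [fourierCoeffOn_eq_integral, intervalIntegral.integral_of_le hab.le, smul_smul,
    sub_neg_eq_add, ← two_mul, mul_one_div_cancel (by positivity), one_smul]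
  congr 1 with y
  simp only [fourier_coe_apply, smul_eq_mul, ← mul_assoc, planeWave, ← Complex.exp_add, alphaj]
  congr 2
  push_cast
  field_simp
  ring

lemma tsum_enorm_sq_integral_planeWave_mul_le (α : ℝ) (m : ℕ) {h : ℝ → ℂ}
    (hh : AEStronglyMeasurable h
      (volume.restrict (Set.Ioc (-(m * Real.pi)) (m * Real.pi)))) :
    ∑' j : ℤ, ‖∫ y in Set.Ioc (-(m * Real.pi)) (m * Real.pi), planeWave (-alphaj α j) y * h y‖ₑ ^ 2
      ≤ ENNReal.ofReal (2 * (m * Real.pi))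
        * ∫⁻ y in Set.Ioc (-(m * Real.pi)) (m * Real.pi), ‖h y‖ₑ ^ 2 := by
  rcases m.eq_zero_or_pos with rfl | hm
  · simp
  have hmπ : 0 < m * Real.pi := by positivity
  have hab : -(m * Real.pi) < m * Real.pi := by linarith
  by_cases htop : ∫⁻ y in Set.Ioc (-(m * Real.pi)) (m * Real.pi), ‖h y‖ₑ ^ 2 = ⊤
  · rw [htop, ENNReal.mul_top (ENNReal.ofReal_pos.mpr (by positivity)).ne']
    exact le_top
  have henorm (y : ℝ) : ‖planeWave (-α) y * h y‖ₑ = ‖h y‖ₑ := by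
    rw [enorm_mul, enorm_planeWave, one_mul]
  have hg : MemLp (fun y => planeWave (-α) y * h y) 2
      (volume.restrict (Set.Ioc (-(m * Real.pi)) (m * Real.pi))) := by
    refine memLp_two_of_lintegral_enorm_sq_lt_top (by fun_prop) ?_
    simpa only [henorm] using lt_top_iff_ne_top.mpr htop
  have hinj : Function.Injective fun j : ℤ => (m : ℤ) * j :=
    mul_right_injective₀ (by exact_mod_cast hm.ne')
  simp only [integral_planeWave_mul_eq_fourierCoeffOn α hab, enorm_smul, mul_pow,
    ENNReal.tsum_mul_left]
  refine (mul_le_mul_right (ENNReal.tsum_comp_le_tsum_of_injective hinj fun n =>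
    ‖fourierCoeffOn hab (fun y => planeWave (-α) y * h y) n‖ₑ ^ 2) _).trans_eq ?_
  rw [tsum_enorm_sq_fourierCoeffOn hab hg, ← mul_assoc, Real.enorm_of_nonneg (by positivity),
    sub_neg_eq_add, ← two_mul, ← ENNReal.ofReal_pow (by positivity),
    ← ENNReal.ofReal_mul (by positivity), sq, mul_inv_cancel_right₀ (by positivity)]
  simp only [henorm]

lemma IsDensity.tsum_lintegral_coeff_sq_le {m : ℕ} {ρ : ℝ} {F : ℝ × ℝ → ℂ} (hF : IsDensity m ρ F)
    (α : ℝ) :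
    ∑' j : ℤ, ∫⁻ y, ‖coeff α F j y‖ₑ ^ 2
      ≤ ENNReal.ofReal (2 * (m * Real.pi)) * ∫⁻ y, ‖F y‖ₑ ^ 2 := by
  have hm := hF.measurable
  have slice_eq_zero (y₁ y₂ : ℝ) (hy : y₁ ∉ Set.Ioc (-(m * Real.pi)) (m * Real.pi)) :
      F (y₁, y₂) = 0 := hF.eq_zero _ fun h => hy (Set.Ioo_subset_Ioc_self h.1)
  have coeff_eq (j : ℤ) (y₂ : ℝ) : coeff α F j y₂
      = ∫ y₁ in Set.Ioc (-(m * Real.pi)) (m * Real.pi), planeWave (-alphaj α j) y₁ * F (y₁, y₂) :=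
    (setIntegral_eq_integral_of_forall_compl_eq_zero fun y₁ hy => by
      rw [slice_eq_zero y₁ y₂ hy, mul_zero]).symm
  rw [← lintegral_tsum fun j => ((hF.measurable_coeff α j).enorm.pow_const 2).aemeasurable]
  calc ∫⁻ y₂, ∑' j : ℤ, ‖coeff α F j y₂‖ₑ ^ 2
      ≤ ∫⁻ y₂, ENNReal.ofReal (2 * (m * Real.pi)) * ∫⁻ y₁, ‖F (y₁, y₂)‖ₑ ^ 2 := by
        refine lintegral_mono fun y₂ => ?_
        simp only [coeff_eq]
        refine (tsum_enorm_sq_integral_planeWave_mul_le α m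
          (h := fun y₁ => F (y₁, y₂))
          (hm.comp measurable_prodMk_right).aestronglyMeasurable).trans ?_
        gcongr
        exact Measure.restrict_le_self
    _ = ENNReal.ofReal (2 * (m * Real.pi)) * ∫⁻ y, ‖F y‖ₑ ^ 2 := by
        rw [lintegral_const_mul _ (by fun_prop), Measure.volume_eq_prod,
          lintegral_prod_symm _ (by fun_prop)]

/-! ### Profiles of the potential -/

/-- The `n`-th weak derivative, for `n ≤ 2`, of the `j`-th Fourier profile `κ_j ∗ F̂_j` of the
potential of `F`. The last summand comes from the jump of `κ_j'` at the origin. -/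
noncomputable def profile (k : ℂ) (α : ℝ) (F : ℝ × ℝ → ℂ) (j : ℤ) (n : ℕ) (x : ℝ) : ℂ :=
  (∫ y, modeKernel k α j n (x - y) * coeff α F j y)
    + (if n = 2 then -(1 / (2 * (Real.pi : ℂ))) else 0) * coeff α F j x

namespace IsDensity

variable {m : ℕ} {ρ : ℝ} {F : ℝ × ℝ → ℂ}

lemma measurable_profile (hF : IsDensity m ρ F) (k : ℂ) (α : ℝ) (j : ℤ) (n : ℕ) :
    Measurable (profile k α F j n) := by
  have hc := hF.measurable_coeff α j
  have hconv : Measurable fun z : ℝ × ℝ => modeKernel k α j n (z.1 - z.2) * coeff α F j z.2 :=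
    ((measurable_modeKernel k α j n).comp measurable_sub).mul (hc.comp measurable_snd)
  exact hconv.stronglyMeasurable.integral_prod_right'.measurable.add (hc.const_mul _)

lemma hasWeakDerivLine_profile {k : ℂ} {α : ℝ} (h : Admissible k α) (hF : IsDensity m ρ F)
    (j : ℤ) {n : ℕ} (hn : n < 2) :
    HasWeakDerivLine (profile k α F j n) (profile k α F j (n + 1)) 0 := by
  have conv := (hasWeakDerivLine_modeKernel h.sq_im_nonneg α j n).conv
    (measurable_modeKernel k α j n) (measurable_modeKernel k α j (n + 1))
    (norm_modeKernel_le h.sq_im_nonneg α j n) (norm_modeKernel_le h.sq_im_nonneg α j (n + 1))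
    (hF.integrable_coeff α j)
  have profile_n : profile k α F j n
      = fun x => ∫ y, modeKernel k α j n (x - y) * coeff α F j y := by
    funext x
    rw [profile, if_neg hn.ne, zero_mul, add_zero]
  have jump : Complex.I / (4 * (Real.pi : ℂ) * betaj k α j) * (Complex.I * betaj k α j) ^ n
      - Complex.I / (4 * (Real.pi : ℂ) * betaj k α j) * (-(Complex.I * betaj k α j)) ^ n
      = if n + 1 = 2 then -(1 / (2 * (Real.pi : ℂ))) else 0 := by
    have hβ := h.betaj_ne_zero j
    have hπ : (Real.pi : ℂ) ≠ 0 := by exact_mod_cast Real.pi_ne_zero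
    interval_cases n
    · simp
    · simp only [pow_one, one_add_one_eq_two, if_true]
      field_simp
      rw [Complex.I_sq]
      norm_num
  rw [jump] at conv
  rwa [profile_n]

end IsDensity

lemma add_sq_le_two_mul (a b : ℝ≥0∞) : (a + b) ^ 2 ≤ 2 * (a ^ 2 + b ^ 2) := by
  have key := ENNReal.rpow_add_le_mul_rpow_add_rpow a b one_le_two
  rwa [show (2 : ℝ) - 1 = 1 by norm_num, ENNReal.rpow_one, ENNReal.rpow_two, ENNReal.rpow_two,
    ENNReal.rpow_two] at key

lemma Admissible.exists_lintegral_conv_modeKernel_sq_le {k : ℂ} {α : ℝ} (h : Admissible k α)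
    {m : ℕ × ℕ} (hm : m.1 + m.2 ≤ 2) (ρ R : ℝ) :
    ∃ C : ℝ≥0, ∀ (j : ℤ) {g : ℝ → ℂ}, Measurable g → (∀ y, ρ ≤ |y| → g y = 0) →
      ∫⁻ x in Set.Ioo (-R) R, ‖∫ y, (Complex.I * alphaj α j) ^ m.1
          * modeKernel k α j m.2 (x - y) * g y‖ₑ ^ 2 ≤ C * ∫⁻ y, ‖g y‖ₑ ^ 2 := by
  obtain ⟨A, hA0, hA⟩ := h.exists_norm_modeKernel_le m.2 (R + ρ)
  refine ⟨Real.toNNReal (2 * A) ^ 2, fun j g hg hsupp => ?_⟩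
  have hw := weight_pos α j
  have norm_le (t : ℝ) (ht : |t| ≤ R + ρ) :
      ‖(Complex.I * alphaj α j) ^ m.1 * modeKernel k α j m.2 t‖
        ≤ A * weight α j ^ (m.1 + m.2) / weight α j * Real.exp (-(weight α j * |t|)) := by
    rw [norm_mul, norm_pow, norm_mul, Complex.norm_I, one_mul, Complex.norm_real, Real.norm_eq_abs]
    calc |alphaj α j| ^ m.1 * ‖modeKernel k α j m.2 t‖
        ≤ weight α j ^ m.1
          * (A * weight α j ^ m.2 / weight α j * Real.exp (-(weight α j * |t|))) := by
          gcongr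
          · exact abs_alphaj_le_weight α j
          · exact hA j t ht
      _ = _ := by ring
  refine (setLIntegral_enorm_sq_conv_le hw (by positivity) hg hsupp norm_le).trans ?_
  gcongr
  rw [ENNReal.coe_pow]
  refine pow_le_pow_left' (ENNReal.ofReal_le_ofReal ?_) 2
  have : weight α j ^ (m.1 + m.2) ≤ weight α j ^ 2 :=
    pow_le_pow_right₀ (one_le_weight α j) hm
  calc 2 * (A * weight α j ^ (m.1 + m.2) / weight α j) / weight α j
      ≤ 2 * (A * weight α j ^ 2 / weight α j) / weight α j := by gcongr
    _ = 2 * A := by field_simp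

lemma Admissible.exists_lintegral_profile_sq_le {k : ℂ} {α : ℝ} (h : Admissible k α)
    {m : ℕ × ℕ} (hm : m.1 + m.2 ≤ 2) (M : ℕ) (ρ R : ℝ) :
    ∃ C : ℝ≥0, ∀ {F : ℝ × ℝ → ℂ}, IsDensity M ρ F → ∀ j : ℤ,
      ∫⁻ x in Set.Ioo (-R) R, ‖(Complex.I * alphaj α j) ^ m.1 * profile k α F j m.2 x‖ₑ ^ 2
        ≤ C * ∫⁻ y, ‖coeff α F j y‖ₑ ^ 2 := by
  obtain ⟨C, hC⟩ := h.exists_lintegral_conv_modeKernel_sq_le hm ρ R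
  refine ⟨2 * (C + 1), fun {F} hF j => ?_⟩
  have hc := hF.measurable_coeff α j
  have norm_jump_le : ‖(Complex.I * alphaj α j) ^ m.1
      * (if m.2 = 2 then -(1 / (2 * (Real.pi : ℂ))) else 0)‖ₑ ≤ 1 := by
    rw [← ofReal_norm, ENNReal.ofReal_le_one]
    split_ifs with h2
    · rw [show m.1 = 0 by omega, pow_zero, one_mul, norm_neg, norm_div, norm_one, norm_mul,
        Complex.norm_two, Complex.norm_real, Real.norm_of_nonneg Real.pi_pos.le]
      exact div_le_one_of_le₀ (by linarith [Real.pi_gt_three]) (by positivity)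
    · simp
  have enorm_sq_le (x : ℝ) : ‖(Complex.I * alphaj α j) ^ m.1 * profile k α F j m.2 x‖ₑ ^ 2
      ≤ 2 * (‖∫ y, (Complex.I * alphaj α j) ^ m.1 * modeKernel k α j m.2 (x - y)
          * coeff α F j y‖ₑ ^ 2 + ‖coeff α F j x‖ₑ ^ 2) := by
    refine le_trans ?_ (add_sq_le_two_mul _ _)
    simp only [profile, mul_add, ← mul_assoc, ← integral_const_mul]
    gcongr
    refine (enorm_add_le _ _).trans ?_
    gcongr
    rw [enorm_mul]
    exact mul_le_of_le_one_left' norm_jump_le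
  calc ∫⁻ x in Set.Ioo (-R) R, ‖(Complex.I * alphaj α j) ^ m.1 * profile k α F j m.2 x‖ₑ ^ 2
      ≤ 2 * ((∫⁻ x in Set.Ioo (-R) R, ‖∫ y, (Complex.I * alphaj α j) ^ m.1
          * modeKernel k α j m.2 (x - y) * coeff α F j y‖ₑ ^ 2)
          + ∫⁻ x in Set.Ioo (-R) R, ‖coeff α F j x‖ₑ ^ 2) := by
        rw [← lintegral_add_right _ (by fun_prop), ← lintegral_const_mul' _ _ ENNReal.ofNat_ne_top]
        exact lintegral_mono enorm_sq_le
    _ ≤ 2 * (C * (∫⁻ y, ‖coeff α F j y‖ₑ ^ 2) + ∫⁻ y, ‖coeff α F j y‖ₑ ^ 2) := by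
        gcongr
        · exact hC j hc fun y hy => hF.coeff_eq_zero α j hy
        · exact Measure.restrict_le_self
    _ = ↑(2 * (C + 1)) * ∫⁻ y, ‖coeff α F j y‖ₑ ^ 2 := by
        push_cast
        ring

/-! ### Orthogonal series -/

lemma exists_hasSum_of_pairwise_orthogonal {𝕜 ι E : Type*} [RCLike 𝕜] [NormedAddCommGroup E]
    [InnerProductSpace 𝕜 E] [CompleteSpace E] {V : ι → E}
    (hV : Pairwise fun i j => inner 𝕜 (V i) (V j) = 0) (hs : ∑' i, ‖V i‖ₑ ^ 2 < ⊤) :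
    ∃ v, HasSum V v ∧ ‖v‖ₑ ^ 2 ≤ ∑' i, ‖V i‖ₑ ^ 2 := by
  have orthogonal : OrthogonalFamily 𝕜 (fun i => Submodule.span 𝕜 {V i})
      fun i => (Submodule.span 𝕜 {V i}).subtypeₗᵢ := by
    refine OrthogonalFamily.of_pairwise fun i j hij => ?_
    simp only [Function.onFun, Submodule.isOrtho_span, Set.mem_singleton_iff, forall_eq]
    exact hV hij
  let W (i : ι) : Submodule.span 𝕜 {V i} := ⟨V i, Submodule.mem_span_singleton_self _⟩
  have ofReal_sq (w : E) : ENNReal.ofReal (‖w‖ ^ 2) = ‖w‖ₑ ^ 2 := by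
    rw [ENNReal.ofReal_pow (norm_nonneg _), ofReal_norm]
  have summable_sq : Summable fun i => ‖V i‖ ^ 2 := by
    simpa only [ENNReal.toReal_pow, toReal_enorm] using ENNReal.summable_toReal hs.ne
  obtain ⟨v, hv⟩ := (orthogonal.summable_iff_norm_sq_summable W).mpr summable_sq
  refine ⟨v, hv, ?_⟩
  have norm_sq_le : ‖v‖ ^ 2 ≤ ∑' i, ‖V i‖ ^ 2 :=
    le_of_tendsto (hv.norm.pow 2) (.of_forall fun s =>
      (orthogonal.norm_sum W s).trans_le (summable_sq.sum_le_tsum s fun i _ => by positivity))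
  simpa only [ofReal_sq, ENNReal.ofReal_tsum_of_nonneg (fun i => sq_nonneg ‖V i‖) summable_sq]
    using ENNReal.ofReal_le_ofReal norm_sq_le

lemma hasSum_integral_mul_of_hasSum_toLp {𝕜 ι X : Type*} [RCLike 𝕜] [MeasurableSpace X]
    {μ : Measure X} {f : ι → X → 𝕜} (hf : ∀ i, MemLp (f i) 2 μ) {v : Lp 𝕜 2 μ}
    (hv : HasSum (fun i => (hf i).toLp) v) {χ : X → 𝕜} (hχ : MemLp χ 2 μ) :
    HasSum (fun i => ∫ x, f i x * χ x ∂μ) (∫ x, v x * χ x ∂μ) := by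
  have inner_star (w : Lp 𝕜 2 μ) : inner 𝕜 hχ.star.toLp w = ∫ x, w x * χ x ∂μ := by
    rw [L2.inner_def]
    refine integral_congr_ae ?_
    filter_upwards [hχ.star.coeFn_toLp] with x hx
    simp [hx, RCLike.inner_apply]
  rw [← inner_star]
  refine (hv.mapL (innerSL 𝕜 hχ.star.toLp)).congr_fun fun i => ?_
  rw [innerSL_apply_apply, inner_star]
  refine integral_congr_ae ?_
  filter_upwards [(hf i).coeFn_toLp] with x hx
  rw [hx]

lemma exists_memLp_hasSum_integral_mul {𝕜 ι X : Type*} [RCLike 𝕜] [MeasurableSpace X]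
    {μ : Measure X} {f : ι → X → 𝕜} (hf : ∀ i, AEStronglyMeasurable (f i) μ)
    (horth : Pairwise fun i j => ∫ x, f j x * starRingEnd 𝕜 (f i x) ∂μ = 0)
    (hfin : ∑' i, ∫⁻ x, ‖f i x‖ₑ ^ 2 ∂μ < ⊤) :
    ∃ v : X → 𝕜, MemLp v 2 μ ∧ eLpNorm v 2 μ ^ 2 ≤ ∑' i, ∫⁻ x, ‖f i x‖ₑ ^ 2 ∂μ ∧
      ∀ χ, MemLp χ 2 μ → HasSum (fun i => ∫ x, f i x * χ x ∂μ) (∫ x, v x * χ x ∂μ) := by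
  have memLp (i : ι) : MemLp (f i) 2 μ :=
    memLp_two_of_lintegral_enorm_sq_lt_top (hf i) ((ENNReal.le_tsum i).trans_lt hfin)
  have enorm_toLp (i : ι) : ‖(memLp i).toLp‖ₑ ^ 2 = ∫⁻ x, ‖f i x‖ₑ ^ 2 ∂μ := by
    rw [Lp.enorm_toLp, eLpNorm_two_sq]
  have orthogonal : Pairwise fun i j => inner 𝕜 (memLp i).toLp (memLp j).toLp = 0 := by
    intro i j hij
    rw [L2.inner_def, ← horth hij]
    refine integral_congr_ae ?_
    filter_upwards [(memLp i).coeFn_toLp, (memLp j).coeFn_toLp] with x hi hj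
    rw [hi, hj, RCLike.inner_apply]
  obtain ⟨v, hv, hle⟩ := exists_hasSum_of_pairwise_orthogonal orthogonal
    (by simpa only [enorm_toLp] using hfin)
  refine ⟨v, Lp.memLp v, ?_, fun χ hχ => hasSum_integral_mul_of_hasSum_toLp memLp hv hχ⟩
  rw [← Lp.enorm_def]
  simpa only [enorm_toLp] using hle

/-- The quasi-periodic mode `exp(i α_j x₁) g(x₂)`. -/
noncomputable def mode (α : ℝ) (j : ℤ) (g : ℝ → ℂ) (x : ℝ × ℝ) : ℂ :=
  planeWave (alphaj α j) x.1 * g x.2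

@[fun_prop]
lemma measurable_mode (α : ℝ) (j : ℤ) {g : ℝ → ℂ} (hg : Measurable g) :
    Measurable (mode α j g) := by
  unfold mode
  fun_prop

lemma enorm_mode (α : ℝ) (j : ℤ) (g : ℝ → ℂ) (x : ℝ × ℝ) : ‖mode α j g x‖ₑ = ‖g x.2‖ₑ := by
  rw [mode, enorm_mul, enorm_planeWave, one_mul]

lemma lintegral_box_snd (m : ℕ) (R : ℝ) {g : ℝ → ℝ≥0∞} (hg : Measurable g) :
    ∫⁻ x in box m R, g x.2
      = ENNReal.ofReal (2 * (m * Real.pi)) * ∫⁻ t in Set.Ioo (-R) R, g t := by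
  rw [box, Measure.volume_eq_prod, ← Measure.prod_restrict, lintegral_prod _ (by fun_prop)]
  simp only [setLIntegral_const, Real.volume_Ioo, sub_neg_eq_add, ← two_mul, mul_comm]

lemma integral_planeWave_intCast_eq_zero {n : ℤ} (hn : n ≠ 0) (m : ℕ) :
    ∫ t in Set.Ioo (-(m * Real.pi)) (m * Real.pi), planeWave n t = 0 := by
  have hc : Complex.I * (n : ℂ) ≠ 0 := mul_ne_zero Complex.I_ne_zero (by exact_mod_cast hn)
  have hm : 0 ≤ m * Real.pi := by positivity
  have periodic : Complex.exp (Complex.I * n * ((m * Real.pi : ℝ) : ℂ))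
      = Complex.exp (Complex.I * n * ((-(m * Real.pi) : ℝ) : ℂ)) := by
    rw [Complex.exp_eq_exp_iff_exists_int]
    exact ⟨n * m, by push_cast; ring⟩
  simp only [planeWave, Complex.ofReal_intCast]
  rw [← integral_Ioc_eq_integral_Ioo, ← intervalIntegral.integral_of_le (by linarith),
    integral_exp_mul_complex hc, periodic, sub_self, zero_div]

lemma integral_box_mode_mul_conj_mode (α : ℝ) {i j : ℤ} (hij : i ≠ j) (g h : ℝ → ℂ) (m : ℕ)
    (R : ℝ) : ∫ x in box m R, mode α j h x * starRingEnd ℂ (mode α i g x) = 0 := by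
  have mode_mul_conj (x : ℝ × ℝ) : mode α j h x * starRingEnd ℂ (mode α i g x)
      = planeWave (j - i : ℤ) x.1 * (h x.2 * starRingEnd ℂ (g x.2)) := by
    simp only [mode, planeWave, map_mul, ← Complex.exp_conj, Complex.conj_I, Complex.conj_ofReal]
    rw [mul_mul_mul_comm, ← Complex.exp_add]
    congr 2
    push_cast [alphaj]
    ring
  simp only [mode_mul_conj]
  rw [box, Measure.volume_eq_prod, ← Measure.prod_restrict,
    integral_prod_mul (planeWave (j - i : ℤ)) (fun t => h t * starRingEnd ℂ (g t)),
    integral_planeWave_intCast_eq_zero (sub_ne_zero.mpr hij.symm), zero_mul]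

lemma exists_memLp_hasSum_integral_mode_mul (α : ℝ) {g : ℤ → ℝ → ℂ} (hg : ∀ j, Measurable (g j))
    (m : ℕ) (R : ℝ) (hfin : ∑' j, ∫⁻ t in Set.Ioo (-R) R, ‖g j t‖ₑ ^ 2 < ⊤) :
    ∃ v : ℝ × ℝ → ℂ, MemLp v 2 (volume.restrict (box m R)) ∧
      eLpNorm v 2 (volume.restrict (box m R)) ^ 2 ≤ ENNReal.ofReal (2 * (m * Real.pi))
        * ∑' j, ∫⁻ t in Set.Ioo (-R) R, ‖g j t‖ₑ ^ 2 ∧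
      ∀ χ : ℝ × ℝ → ℂ, MemLp χ 2 (volume.restrict (box m R)) →
        HasSum (fun j => ∫ x in box m R, mode α j (g j) x * χ x) (∫ x in box m R, v x * χ x) := by
  have sum_eq : ∑' j, ∫⁻ x in box m R, ‖mode α j (g j) x‖ₑ ^ 2
      = ENNReal.ofReal (2 * (m * Real.pi)) * ∑' j, ∫⁻ t in Set.Ioo (-R) R, ‖g j t‖ₑ ^ 2 := by
    rw [← ENNReal.tsum_mul_left]
    refine tsum_congr fun j => ?_
    simp only [enorm_mode]
    exact lintegral_box_snd m R ((hg j).enorm.pow_const 2)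
  rw [← sum_eq]
  exact exists_memLp_hasSum_integral_mul
    (fun j => (measurable_mode α j (hg j)).aestronglyMeasurable)
    (fun i j hij => integral_box_mode_mul_conj_mode α hij (g i) (g j) m R)
    (sum_eq ▸ ENNReal.mul_lt_top ENNReal.ofReal_lt_top hfin)

/-! ### The potential as a series of modes -/

lemma integrable_tsum_and_hasSum_integral {ι X E : Type*} [Countable ι] [MeasurableSpace X]
    [NormedAddCommGroup E] [NormedSpace ℝ E] [CompleteSpace E]
    {μ : Measure X} {f : ι → X → E} (hf : ∀ i, AEStronglyMeasurable (f i) μ)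
    (h : ∑' i, ∫⁻ x, ‖f i x‖ₑ ∂μ < ⊤) :
    Integrable (fun x => ∑' i, f i x) μ ∧
      HasSum (fun i => ∫ x, f i x ∂μ) (∫ x, ∑' i, f i x ∂μ) := by
  have hfm (i : ι) : AEMeasurable (fun x => ‖f i x‖ₑ) μ := (hf i).enorm
  have hfi (i : ι) : Integrable (f i) μ := ⟨hf i, (ENNReal.le_tsum i).trans_lt h⟩
  have ae_summable : ∀ᵐ x ∂μ, Summable fun i => f i x := by
    rw [← lintegral_tsum hfm] at h
    filter_upwards [ae_lt_top' (AEMeasurable.tsum hfm) h.ne] with x hx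
    exact .of_norm (by simpa using ENNReal.summable_toReal hx.ne)
  refine ⟨⟨aestronglyMeasurable_of_tendsto_ae (Filter.atTop : Filter (Finset ι))
    (f := fun s x => ∑ i ∈ s, f i x)
    (fun s => Finset.aestronglyMeasurable_fun_sum s fun i _ => hf i) ?_, ?_⟩, ?_⟩
  · filter_upwards [ae_summable] with x hx using hx.hasSum
  · exact (lintegral_mono fun x => enorm_tsum_le_tsum_enorm).trans_lt
      ((lintegral_tsum hfm).trans_lt h)
  · refine hasSum_integral_of_summable_integral_norm hfi ?_
    simpa only [integral_norm_eq_lintegral_enorm (hf _)] using ENNReal.summable_toReal h.ne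

/-- The volume potential of a density on the plane. -/
noncomputable def potential (k : ℂ) (α : ℝ) (F : ℝ × ℝ → ℂ) (x : ℝ × ℝ) : ℂ :=
  ∫ y, green k α (x - y) * F y

lemma Admissible.green_eq_tsum_mode {k : ℂ} {α : ℝ} (h : Admissible k α) {x : ℝ × ℝ}
    (hx : x.2 ≠ 0) : green k α x = ∑' j : ℤ, mode α j (modeKernel k α j 0) x := by
  have mode_eq (j : ℤ) : mode α j (modeKernel k α j 0) x
      = Complex.I / (4 * (Real.pi : ℂ)) * ((1 / betaj k α j) *
        Complex.exp (Complex.I * (alphaj α j : ℂ) * (x.1 : ℂ)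
          + Complex.I * betaj k α j * ((|x.2| : ℝ) : ℂ))) := by
    rw [mode, planeWave, modeKernel, Complex.exp_add, pow_zero, ← div_div]
    ring
  have summable_mode : Summable fun j : ℤ => mode α j (modeKernel k α j 0) x := by
    obtain ⟨A, hA0, hA⟩ := h.exists_norm_modeKernel_le 0 |x.2|
    have := abs_pos.mpr hx
    refine ((summable_weight_rpow α one_lt_two).mul_left (A / |x.2|)).of_norm_bounded fun j => ?_
    have hw := weight_pos α j
    have exp_le : Real.exp (-(weight α j * |x.2|)) ≤ (weight α j * |x.2|)⁻¹ := by
      rw [Real.exp_neg]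
      gcongr
      linarith [Real.add_one_le_exp (weight α j * |x.2|)]
    rw [mode, norm_mul, norm_planeWave, one_mul]
    calc ‖modeKernel k α j 0 x.2‖
        ≤ A * weight α j ^ 0 / weight α j * (weight α j * |x.2|)⁻¹ :=
          (hA j x.2 le_rfl).trans (by gcongr)
      _ = A / |x.2| * weight α j ^ (-2 : ℝ) := by
          rw [Real.rpow_neg hw.le, Real.rpow_two]
          field_simp
  have hc : Complex.I / (4 * (Real.pi : ℂ)) ≠ 0 := by simp [Real.pi_ne_zero]
  simp only [mode_eq, summable_mul_left_iff hc] at summable_mode ⊢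
  rw [green, tsum_eq_of_summable_unconditional summable_mode, tsum_mul_left]

lemma tsum_ofReal_weight_rpow_lt_top (α : ℝ) {s : ℝ} (hs : 1 < s) :
    ∑' j : ℤ, ENNReal.ofReal (weight α j ^ (-s)) < ⊤ := by
  rw [← ENNReal.ofReal_tsum_of_nonneg (fun j => Real.rpow_nonneg (weight_pos α j).le _)
    (summable_weight_rpow α hs)]
  exact ENNReal.ofReal_lt_top

lemma ae_snd_ne (t : ℝ) : ∀ᵐ y : ℝ × ℝ, y.2 ≠ t :=
  Measure.quasiMeasurePreserving_snd.ae (Measure.ae_ne volume t)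

namespace IsDensity

variable {m : ℕ} {ρ : ℝ} {F : ℝ × ℝ → ℂ}

lemma lintegral_enorm_sq_lt_top (hF : IsDensity m ρ F) : ∫⁻ y, ‖F y‖ₑ ^ 2 < ⊤ := by
  rw [← eLpNorm_two_sq]
  exact ENNReal.pow_lt_top hF.memLp.eLpNorm_lt_top

lemma setLIntegral_box_eq (hF : IsDensity m ρ F) (g : ℝ × ℝ → ℝ≥0∞) :
    ∫⁻ y in box m ρ, g y * ‖F y‖ₑ = ∫⁻ y, g y * ‖F y‖ₑ := by
  refine setLIntegral_eq_of_support_subset fun y hy => ?_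
  by_contra hn
  exact hy (by simp [hF.eq_zero y hn])

lemma sq_lintegral_exp_mul_enorm_le (hF : IsDensity m ρ F) {a : ℝ} (ha : 0 < a) (t : ℝ) :
    (∫⁻ y, ENNReal.ofReal (Real.exp (-(a * |t - y.2|))) * ‖F y‖ₑ) ^ 2
      ≤ ENNReal.ofReal (2 * (m * Real.pi)) * ENNReal.ofReal (2 / a) * ∫⁻ y, ‖F y‖ₑ ^ 2 := by
  have hm := hF.measurable
  have exp_le_one (y : ℝ × ℝ) : ENNReal.ofReal (Real.exp (-(a * |t - y.2|))) ≤ 1 :=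
    ENNReal.ofReal_le_one.mpr (Real.exp_le_one_iff.mpr (neg_nonpos.mpr (by positivity)))
  rw [← hF.setLIntegral_box_eq]
  refine (sq_lintegral_mul_le (by fun_prop) (by fun_prop)).trans (mul_le_mul' ?_ ?_)
  · rw [lintegral_box_snd m ρ
      (g := fun s => ENNReal.ofReal (Real.exp (-(a * |t - s|)))) (by fun_prop)]
    gcongr
    refine (setLIntegral_le_lintegral _ _).trans_eq ?_
    rw [lintegral_sub_left_eq_self (fun s => ENNReal.ofReal (Real.exp (-(a * |s|)))),
      lintegral_exp_neg_mul_abs ha]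
  · exact (setLIntegral_le_lintegral _ _).trans
      (lintegral_mono fun y => mul_le_of_le_one_left' (exp_le_one y))

lemma exists_lintegral_mode_sub_mul_le {k : ℂ} {α : ℝ} (h : Admissible k α)
    (hF : IsDensity m ρ F) (R : ℝ) :
    ∃ C : ℝ≥0, ∀ (j : ℤ) (x : ℝ × ℝ), |x.2| ≤ R →
      ∫⁻ y, ‖mode α j (modeKernel k α j 0) (x - y) * F y‖ₑ
        ≤ C * ENNReal.ofReal (weight α j ^ (-(3 / 2) : ℝ)) := by
  obtain ⟨A, hA0, hA⟩ := h.exists_norm_modeKernel_le 0 (R + ρ)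
  set S : ℝ := 2 * (m * Real.pi) * 2 * (∫⁻ y, ‖F y‖ₑ ^ 2).toReal with hS
  refine ⟨Real.toNNReal (A * √S), fun j x hx => ?_⟩
  have hw := weight_pos α j
  set q : ℝ≥0∞ := ∫⁻ y, ENNReal.ofReal (Real.exp (-(weight α j * |x.2 - y.2|))) * ‖F y‖ₑ
  have lintegral_le : ∫⁻ y, ‖mode α j (modeKernel k α j 0) (x - y) * F y‖ₑ
      ≤ ENNReal.ofReal (A / weight α j) * q := by
    rw [← lintegral_const_mul' _ _ ENNReal.ofReal_ne_top]
    refine lintegral_mono fun y => ?_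
    by_cases hy : y ∈ box m ρ
    · have hxy : |x.2 - y.2| ≤ R + ρ :=
        (abs_sub _ _).trans (add_le_add hx (abs_lt.mpr hy.2).le)
      rw [enorm_mul, enorm_mode, ← mul_assoc, ← ENNReal.ofReal_mul (by positivity), ← ofReal_norm]
      gcongr
      simpa only [pow_zero, mul_one, Prod.snd_sub] using hA j _ hxy
    · simp [hF.eq_zero y hy]
  have q_le : q ≤ ENNReal.ofReal (√S * weight α j ^ (-(1 / 2) : ℝ)) := by
    rw [← ENNReal.pow_le_pow_left_iff two_ne_zero]
    refine (hF.sq_lintegral_exp_mul_enorm_le hw x.2).trans_eq ?_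
    rw [← ENNReal.ofReal_toReal hF.lintegral_enorm_sq_lt_top.ne,
      ← ENNReal.ofReal_mul (by positivity), ← ENNReal.ofReal_mul (by positivity),
      ← ENNReal.ofReal_pow (by positivity), mul_pow, Real.sq_sqrt (by positivity),
      ← Real.rpow_mul_natCast hw.le]
    congr 1
    rw [show (-(1 / 2) * (2 : ℕ) : ℝ) = -1 by norm_num, Real.rpow_neg_one, hS]
    ring
  refine lintegral_le.trans ((mul_le_mul_right q_le _).trans_eq ?_)
  rw [← ENNReal.ofReal_mul (by positivity)]
  change _ = ENNReal.ofReal _ * _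
  rw [← ENNReal.ofReal_mul (by positivity), show (-(3 / 2) : ℝ) = -1 + -(1 / 2) by norm_num,
    Real.rpow_add hw, Real.rpow_neg_one]
  congr 1
  ring

lemma measurable_mode_sub_mul (hF : IsDensity m ρ F) (k : ℂ) (α : ℝ) (j : ℤ) (x : ℝ × ℝ) :
    Measurable fun y => mode α j (modeKernel k α j 0) (x - y) * F y :=
  ((measurable_mode α j (measurable_modeKernel k α j 0)).comp
    (measurable_const.sub measurable_id)).mul hF.measurable

lemma integral_mode_sub_mul {k : ℂ} {α : ℝ} (h : Admissible k α) (hF : IsDensity m ρ F) (j : ℤ)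
    (x : ℝ × ℝ) :
    ∫ y, mode α j (modeKernel k α j 0) (x - y) * F y = mode α j (profile k α F j 0) x := by
  obtain ⟨C, hC⟩ := hF.exists_lintegral_mode_sub_mul_le h |x.2|
  have integrable : Integrable fun y => mode α j (modeKernel k α j 0) (x - y) * F y :=
    ⟨(hF.measurable_mode_sub_mul k α j x).aestronglyMeasurable,
      (hC j x le_rfl).trans_lt (ENNReal.mul_lt_top ENNReal.coe_lt_top ENNReal.ofReal_lt_top)⟩
  rw [Measure.volume_eq_prod] at integrable ⊢
  rw [integral_prod_symm _ integrable, mode, profile, if_neg (by norm_num), zero_mul, add_zero,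
    ← integral_const_mul]
  simp only [coeff, ← integral_const_mul, mode, Prod.fst_sub, Prod.snd_sub, planeWave_sub]
  congr 1 with y₂
  congr 1 with y₁
  ring

lemma integrable_green_mul_and_hasSum {k : ℂ} {α : ℝ} (h : Admissible k α) (hF : IsDensity m ρ F)
    (x : ℝ × ℝ) :
    Integrable (fun y => green k α (x - y) * F y) ∧
      HasSum (fun j => mode α j (profile k α F j 0) x) (potential k α F x) := by
  obtain ⟨C, hC⟩ := hF.exists_lintegral_mode_sub_mul_le h |x.2|
  have hfin : ∑' j, ∫⁻ y, ‖mode α j (modeKernel k α j 0) (x - y) * F y‖ₑ < ⊤ := by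
    refine (ENNReal.tsum_le_tsum fun j => hC j x le_rfl).trans_lt ?_
    rw [ENNReal.tsum_mul_left]
    exact ENNReal.mul_lt_top ENNReal.coe_lt_top (tsum_ofReal_weight_rpow_lt_top α (by norm_num))
  obtain ⟨integrable, hasSum⟩ := integrable_tsum_and_hasSum_integral
    (fun j => (hF.measurable_mode_sub_mul k α j x).aestronglyMeasurable) hfin
  have ae_eq_green : (fun y => ∑' j, mode α j (modeKernel k α j 0) (x - y) * F y)
      =ᵐ[volume] fun y => green k α (x - y) * F y := by
    filter_upwards [ae_snd_ne x.2] with y hy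
    rw [tsum_mul_right, h.green_eq_tsum_mode (sub_ne_zero.mpr hy.symm)]
  refine ⟨integrable.congr ae_eq_green, ?_⟩
  rw [potential, ← integral_congr_ae ae_eq_green]
  simpa only [hF.integral_mode_sub_mul h] using hasSum

lemma integrableOn_potential_mul_and_hasSum {k : ℂ} {α : ℝ} (h : Admissible k α)
    (hF : IsDensity m ρ F) (M : ℕ) (R : ℝ) {χ : ℝ × ℝ → ℂ} (hχ : Measurable χ) {K : ℝ}
    (hK : ∀ x, ‖χ x‖ ≤ K) :
    IntegrableOn (fun x => potential k α F x * χ x) (box M R) ∧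
      HasSum (fun j => ∫ x in box M R, mode α j (profile k α F j 0) x * χ x)
        (∫ x in box M R, potential k α F x * χ x) := by
  obtain ⟨C, hC⟩ := hF.exists_lintegral_mode_sub_mul_le h R
  have lintegral_le (j : ℤ) : ∫⁻ x in box M R, ‖mode α j (profile k α F j 0) x * χ x‖ₑ
      ≤ C * ENNReal.ofReal (weight α j ^ (-(3 / 2) : ℝ))
        * (ENNReal.ofReal K * volume (box M R)) := by
    rw [← mul_assoc, ← setLIntegral_const]
    refine setLIntegral_mono measurable_const fun x hx => ?_
    rw [enorm_mul, ← hF.integral_mode_sub_mul h]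
    gcongr
    · exact (enorm_integral_le_lintegral_enorm _).trans (hC j x (abs_lt.mpr hx.2).le)
    · rw [← ofReal_norm]
      exact ENNReal.ofReal_le_ofReal (hK x)
  have hfin : ∑' j, ∫⁻ x in box M R, ‖mode α j (profile k α F j 0) x * χ x‖ₑ < ⊤ := by
    refine (ENNReal.tsum_le_tsum lintegral_le).trans_lt ?_
    rw [ENNReal.tsum_mul_right, ENNReal.tsum_mul_left]
    exact ENNReal.mul_lt_top
      (ENNReal.mul_lt_top ENNReal.coe_lt_top (tsum_ofReal_weight_rpow_lt_top α (by norm_num)))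
      (ENNReal.mul_lt_top ENNReal.ofReal_lt_top (volume_box_lt_top M R))
  simpa only [IntegrableOn, Pi.mul_apply, tsum_mul_right,
    (hF.integrable_green_mul_and_hasSum h _).2.tsum_eq] using
    integrable_tsum_and_hasSum_integral (fun j =>
      ((measurable_mode α j (hF.measurable_profile k α j 0)).mul hχ).aestronglyMeasurable) hfin

end IsDensity

/-! ### Calculus of weak derivatives -/

/-- A smooth function with compact support in `U`, as used to test weak derivatives in `U`. -/
structure IsTest (U : Set (ℝ × ℝ)) (φ : ℝ × ℝ → ℂ) : Prop where
  contDiff : ContDiff ℝ ∞ φ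
  hasCompactSupport : HasCompactSupport φ
  tsupport_subset : tsupport φ ⊆ U

namespace IsTest

variable {U U' : Set (ℝ × ℝ)} {φ u : ℝ × ℝ → ℂ}

lemma mono (hφ : IsTest U' φ) (hU : U' ⊆ U) : IsTest U φ :=
  ⟨hφ.contDiff, hφ.hasCompactSupport, hφ.tsupport_subset.trans hU⟩

lemma fderiv_apply (hφ : IsTest U φ) (e : ℝ × ℝ) : IsTest U fun x => fderiv ℝ φ x e :=
  ⟨(hφ.contDiff.fderiv_right (by simp)).clm_apply contDiff_const,
    hφ.hasCompactSupport.fderiv_apply ℝ e,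
    (tsupport_fderiv_apply_subset ℝ e).trans hφ.tsupport_subset⟩

lemma pderiv₁_iterate (hφ : IsTest U φ) (n : ℕ) : IsTest U (pderiv₁^[n] φ) :=
  Function.Iterate.rec (IsTest U) hφ (fun _ hψ => hψ.fderiv_apply (1, 0)) n

lemma pderiv₂_iterate (hφ : IsTest U φ) (n : ℕ) : IsTest U (pderiv₂^[n] φ) :=
  Function.Iterate.rec (IsTest U) hφ (fun _ hψ => hψ.fderiv_apply (0, 1)) n

lemma exists_norm_le (hφ : IsTest U φ) : ∃ K, ∀ x, ‖φ x‖ ≤ K :=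
  hφ.hasCompactSupport.exists_bound_of_continuous hφ.contDiff.continuous

lemma mul_eq_zero_of_notMem (hφ : IsTest U φ) (u : ℝ × ℝ → ℂ) {x : ℝ × ℝ} (hx : x ∉ U) :
    u x * φ x = 0 := by
  rw [image_eq_zero_of_notMem_tsupport fun h => hx (hφ.tsupport_subset h), mul_zero]

lemma setIntegral_mul_eq (hφ : IsTest U φ) (u : ℝ × ℝ → ℂ) :
    ∫ x in U, u x * φ x = ∫ x, u x * φ x :=
  setIntegral_eq_integral_of_forall_compl_eq_zero fun _ => hφ.mul_eq_zero_of_notMem u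

lemma integrable_mul (hφ : IsTest U φ) (hu : LocallyIntegrableOn u U) :
    Integrable fun x => u x * φ x := by
  obtain ⟨K, hK⟩ := hφ.exists_norm_le
  have hsupp : IntegrableOn (fun x => u x * φ x) (tsupport φ) :=
    (hu.integrableOn_compact_subset hφ.tsupport_subset hφ.hasCompactSupport.isCompact).mul_bdd
      (c := K) hφ.contDiff.continuous.aestronglyMeasurable (Filter.Eventually.of_forall hK)
  exact hsupp.integrable_of_forall_notMem_eq_zero fun x hx => by
    rw [image_eq_zero_of_notMem_tsupport hx, mul_zero]

lemma hasDerivAt_fst (hφ : IsTest U φ) (t s : ℝ) :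
    HasDerivAt (fun t => φ (t, s)) (pderiv₁ φ (t, s)) t :=
  (hφ.contDiff.differentiable (by simp) (t, s)).hasFDerivAt.comp_hasDerivAt t
    ((hasDerivAt_id t).prodMk (hasDerivAt_const t s))

lemma hasDerivAt_snd (hφ : IsTest U φ) (t s : ℝ) :
    HasDerivAt (fun s => φ (t, s)) (pderiv₂ φ (t, s)) s :=
  (hφ.contDiff.differentiable (by simp) (t, s)).hasFDerivAt.comp_hasDerivAt s
    ((hasDerivAt_const s t).prodMk (hasDerivAt_id s))

lemma hasCompactSupport_fst (hφ : IsTest U φ) (s : ℝ) : HasCompactSupport fun t => φ (t, s) :=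
  .intro (hφ.hasCompactSupport.isCompact.image continuous_fst) fun t ht =>
    image_eq_zero_of_notMem_tsupport fun h => ht ⟨(t, s), h, rfl⟩

lemma hasCompactSupport_snd (hφ : IsTest U φ) (t : ℝ) : HasCompactSupport fun s => φ (t, s) :=
  .intro (hφ.hasCompactSupport.isCompact.image continuous_snd) fun s hs =>
    image_eq_zero_of_notMem_tsupport fun h => hs ⟨(t, s), h, rfl⟩

end IsTest

lemma hasWeakDeriv_iff {U : Set (ℝ × ℝ)} {m : ℕ × ℕ} {u v : ℝ × ℝ → ℂ} :
    HasWeakDeriv U m u v ↔ LocallyIntegrableOn u U ∧ LocallyIntegrableOn v U ∧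
      ∀ φ, IsTest U φ → ∫ x, u x * (pderiv₁^[m.1] (pderiv₂^[m.2] φ)) x
        = (-1) ^ (m.1 + m.2) * ∫ x, v x * φ x := by
  refine and_congr_right' (and_congr_right'
    ⟨fun h φ hφ => ?_, fun h φ hφ hφc hφU => ?_⟩)
  · have hψ := (hφ.pderiv₂_iterate m.2).pderiv₁_iterate m.1
    rw [← hψ.setIntegral_mul_eq, ← hφ.setIntegral_mul_eq]
    exact h φ hφ.contDiff hφ.hasCompactSupport hφ.tsupport_subset
  · have hφ : IsTest U φ := ⟨hφ, hφc, hφU⟩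
    have hψ := (hφ.pderiv₂_iterate m.2).pderiv₁_iterate m.1
    rw [hψ.setIntegral_mul_eq, hφ.setIntegral_mul_eq]
    exact h φ hφ

lemma locallyIntegrable_mul_prod {g h : ℝ → ℂ} (hg : LocallyIntegrable g)
    (hh : LocallyIntegrable h) : LocallyIntegrable fun x : ℝ × ℝ => g x.1 * h x.2 := by
  refine locallyIntegrable_iff.mpr fun K hK => ?_
  have hprod : IntegrableOn (fun x : ℝ × ℝ => g x.1 * h x.2)
      ((Prod.fst '' K) ×ˢ (Prod.snd '' K)) := by
    rw [IntegrableOn, Measure.volume_eq_prod, ← Measure.prod_restrict]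
    exact (hg.integrableOn_isCompact (hK.image continuous_fst)).mul_prod
      (hh.integrableOn_isCompact (hK.image continuous_snd))
  exact hprod.mono_set Set.subset_fst_image_prod_snd_image

section

variable {g g' h h' : ℝ → ℂ}

lemma HasWeakDerivLine.hasWeakDeriv_fst (hg : HasWeakDerivLine g g' 0)
    (hh : LocallyIntegrable h) (U : Set (ℝ × ℝ)) :
    HasWeakDeriv U (1, 0) (fun x => g x.1 * h x.2) (fun x => g' x.1 * h x.2) := by
  have hu := (locallyIntegrable_mul_prod hg.locallyIntegrable hh).locallyIntegrableOn U
  have hv := (locallyIntegrable_mul_prod hg.locallyIntegrable_deriv hh).locallyIntegrableOn U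
  refine hasWeakDeriv_iff.mpr ⟨hu, hv, fun φ hφ => ?_⟩
  have slice (s : ℝ) : ∫ t, g t * pderiv₁ φ (t, s) = -∫ t, g' t * φ (t, s) := by
    have key := hg.integral_mul_deriv (fun t => φ (t, s))
      ((hφ.contDiff.comp (by fun_prop)).of_le (by simp)) (hφ.hasCompactSupport_fst s)
    simpa only [(hφ.hasDerivAt_fst _ s).deriv, zero_mul, neg_zero, zero_sub] using key
  have iu : Integrable fun x : ℝ × ℝ => g x.1 * h x.2 * pderiv₁ φ x :=
    (hφ.pderiv₁_iterate 1).integrable_mul hu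
  have iv := hφ.integrable_mul hv
  simp only [Function.iterate_one, Function.iterate_zero, id]
  rw [Measure.volume_eq_prod] at iu iv ⊢
  rw [integral_prod_symm _ iu, integral_prod_symm _ iv, add_zero, pow_one, neg_one_mul,
    ← integral_neg]
  congr 1 with s
  simp only [mul_comm _ (h s), mul_assoc, integral_const_mul, slice, mul_neg]

lemma HasWeakDerivLine.hasWeakDeriv_snd (hh : HasWeakDerivLine h h' 0)
    (hg : LocallyIntegrable g) (U : Set (ℝ × ℝ)) :
    HasWeakDeriv U (0, 1) (fun x => g x.1 * h x.2) (fun x => g x.1 * h' x.2) := by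
  have hu := (locallyIntegrable_mul_prod hg hh.locallyIntegrable).locallyIntegrableOn U
  have hv := (locallyIntegrable_mul_prod hg hh.locallyIntegrable_deriv).locallyIntegrableOn U
  refine hasWeakDeriv_iff.mpr ⟨hu, hv, fun φ hφ => ?_⟩
  have slice (t : ℝ) : ∫ s, h s * pderiv₂ φ (t, s) = -∫ s, h' s * φ (t, s) := by
    have key := hh.integral_mul_deriv (fun s => φ (t, s))
      ((hφ.contDiff.comp (by fun_prop)).of_le (by simp)) (hφ.hasCompactSupport_snd t)
    simpa only [(hφ.hasDerivAt_snd t _).deriv, zero_mul, neg_zero, zero_sub] using key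
  have iu : Integrable fun x : ℝ × ℝ => g x.1 * h x.2 * pderiv₂ φ x :=
    (hφ.pderiv₂_iterate 1).integrable_mul hu
  have iv := hφ.integrable_mul hv
  simp only [Function.iterate_one, Function.iterate_zero, id]
  rw [Measure.volume_eq_prod] at iu iv ⊢
  rw [integral_prod _ iu, integral_prod _ iv, zero_add, pow_one, neg_one_mul, ← integral_neg]
  congr 1 with t
  simp only [mul_assoc, integral_const_mul, slice, mul_neg]

end

namespace HasWeakDeriv

variable {U U' : Set (ℝ × ℝ)} {m n : ℕ × ℕ} {u v w φ : ℝ × ℝ → ℂ}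

lemma integral_mul_pderiv_eq (h : HasWeakDeriv U m u v) (hφ : IsTest U φ) :
    ∫ x, u x * (pderiv₁^[m.1] (pderiv₂^[m.2] φ)) x
      = (-1) ^ (m.1 + m.2) * ∫ x, v x * φ x :=
  (hasWeakDeriv_iff.mp h).2.2 φ hφ

lemma refl (hu : LocallyIntegrableOn u U) : HasWeakDeriv U 0 u u :=
  hasWeakDeriv_iff.mpr ⟨hu, hu, fun φ _ => by simp⟩

lemma trans (hv : HasWeakDeriv U m u v) (hw : HasWeakDeriv U n v w) (hmn : m.2 = 0 ∨ n.1 = 0) :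
    HasWeakDeriv U (m + n) u w := by
  refine hasWeakDeriv_iff.mpr ⟨hv.1, hw.2.1, fun φ hφ => ?_⟩
  have iterate_add : pderiv₁^[(m + n).1] (pderiv₂^[(m + n).2] φ)
      = pderiv₁^[m.1] (pderiv₂^[m.2] (pderiv₁^[n.1] (pderiv₂^[n.2] φ))) := by
    rw [Prod.fst_add, Prod.snd_add, Function.iterate_add_apply, Function.iterate_add_apply]
    rcases hmn with h | h <;> simp [h]
  rw [iterate_add, hv.integral_mul_pderiv_eq ((hφ.pderiv₂_iterate n.2).pderiv₁_iterate n.1),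
    hw.integral_mul_pderiv_eq hφ, Prod.fst_add, Prod.snd_add]
  ring

lemma mono (h : HasWeakDeriv U m u v) (hU : U' ⊆ U) : HasWeakDeriv U' m u v :=
  hasWeakDeriv_iff.mpr ⟨h.1.mono_set hU, h.2.1.mono_set hU,
    fun _ hφ => h.integral_mul_pderiv_eq (hφ.mono hU)⟩

lemma of_hasSum {ι : Type*} {u' v' : ι → ℝ × ℝ → ℂ} (h : ∀ i, HasWeakDeriv U m (u' i) (v' i))
    (hu : LocallyIntegrableOn u U) (hv : LocallyIntegrableOn v U)
    (hsum_u : ∀ φ, IsTest U φ → HasSum (fun i => ∫ x in U, u' i x * φ x) (∫ x in U, u x * φ x))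
    (hsum_v : ∀ φ, IsTest U φ → HasSum (fun i => ∫ x in U, v' i x * φ x) (∫ x in U, v x * φ x)) :
    HasWeakDeriv U m u v :=
  ⟨hu, hv, fun φ h1 h2 h3 =>
    (hsum_u _ ((IsTest.pderiv₂_iterate ⟨h1, h2, h3⟩ m.2).pderiv₁_iterate m.1)).unique
      (((hsum_v φ ⟨h1, h2, h3⟩).mul_left _).congr_fun fun i => (h i).2.2 φ h1 h2 h3)⟩

lemma ae_eq (hU : IsOpen U) (hv : HasWeakDeriv U m u v) (hw : HasWeakDeriv U m u w) :
    v =ᵐ[volume.restrict U] w := by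
  have sub_ae_eq_zero : ∀ᵐ x, x ∈ U → (v - w) x = 0 := by
    refine hU.ae_eq_zero_of_integral_contDiff_smul_eq_zero (hv.2.1.sub hw.2.1)
      fun g hg hgc hgU => ?_
    have hφ : IsTest U fun x => (g x : ℂ) :=
      ⟨Complex.ofRealCLM.contDiff.comp hg, hgc.comp_left Complex.ofReal_zero,
        (tsupport_comp_subset Complex.ofReal_zero g).trans hgU⟩
    have pairing_eq := mul_left_cancel₀ (pow_ne_zero _ (by norm_num))
      ((hv.integral_mul_pderiv_eq hφ).symm.trans (hw.integral_mul_pderiv_eq hφ))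
    simp only [Pi.sub_apply, Complex.real_smul, mul_comm, mul_sub]
    rw [integral_sub (hφ.integrable_mul hv.2.1) (hφ.integrable_mul hw.2.1), pairing_eq, sub_self]
  filter_upwards [(ae_restrict_iff' hU.measurableSet).mpr sub_ae_eq_zero] with x hx
    using sub_eq_zero.mp hx

lemma eLpNorm_weakDeriv (hU : IsOpen U) (hv : HasWeakDeriv U m u v) (p : ℝ≥0∞) :
    eLpNorm (weakDeriv U m u) p (volume.restrict U) = eLpNorm v p (volume.restrict U) := by
  have h : ∃ v, HasWeakDeriv U m u v := ⟨v, hv⟩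
  rw [weakDeriv, dif_pos h]
  exact eLpNorm_congr_ae (h.choose_spec.ae_eq hU hv)

end HasWeakDeriv

lemma MemH.mono {ℓ : ℕ} {U U' : Set (ℝ × ℝ)} {u : ℝ × ℝ → ℂ} (h : MemH ℓ U u) (hU : U' ⊆ U) :
    MemH ℓ U' u := fun m hm =>
  let ⟨v, hv, hv'⟩ := h m hm
  ⟨v, hv.mono hU, hv'.mono_measure (Measure.restrict_mono_set _ hU)⟩

/-! ### Weak derivatives of the potential -/

lemma hasWeakDerivLine_planeWave (a : ℝ) :
    HasWeakDerivLine (planeWave a) (fun t => Complex.I * (a : ℂ) * planeWave a t) 0 := by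
  have hc := continuous_planeWave a
  rw [← sub_self (planeWave a 0)]
  exact .of_hasDerivAt hc.locallyIntegrable (continuous_const.mul hc).locallyIntegrable
    (fun t _ => hasDerivAt_planeWave a t) hc.continuousWithinAt hc.continuousWithinAt

lemma hasWeakDeriv_planeWave_mul (a : ℝ) {g : ℝ → ℂ} (hg : LocallyIntegrable g)
    (U : Set (ℝ × ℝ)) (n : ℕ) :
    HasWeakDeriv U (n, 0) (fun x => planeWave a x.1 * g x.2)
      (fun x => (Complex.I * (a : ℂ)) ^ n * planeWave a x.1 * g x.2) := by
  induction n with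
  | zero =>
    simp only [pow_zero, one_mul]
    exact .refl ((locallyIntegrable_mul_prod
      (continuous_planeWave _).locallyIntegrable hg).locallyIntegrableOn U)
  | succ n ih =>
    have hg' : LocallyIntegrable fun t => (Complex.I * (a : ℂ)) ^ n * g t :=
      hg.smul ((Complex.I * (a : ℂ)) ^ n)
    have step : HasWeakDeriv U (1, 0) (fun x => (Complex.I * (a : ℂ)) ^ n * planeWave a x.1 * g x.2)
        (fun x => (Complex.I * (a : ℂ)) ^ (n + 1) * planeWave a x.1 * g x.2) := by
      convert (hasWeakDerivLine_planeWave a).hasWeakDeriv_fst hg' U using 2 <;> ring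
    exact ih.trans step (.inl rfl)

namespace IsDensity

variable {k : ℂ} {α : ℝ} {M : ℕ} {ρ : ℝ} {F : ℝ × ℝ → ℂ}

lemma hasWeakDeriv_mul_profile (h : Admissible k α) (hF : IsDensity M ρ F) (j : ℤ) {w : ℝ → ℂ}
    (hw : LocallyIntegrable w) (U : Set (ℝ × ℝ)) {n : ℕ} (hn : n ≤ 2) :
    HasWeakDeriv U (0, n) (fun x => w x.1 * profile k α F j 0 x.2)
      (fun x => w x.1 * profile k α F j n x.2) := by
  induction n with
  | zero =>
    exact .refl ((locallyIntegrable_mul_prod hw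
      (hF.hasWeakDerivLine_profile h j two_pos).locallyIntegrable).locallyIntegrableOn U)
  | succ n ih =>
    exact (ih (by omega)).trans
      ((hF.hasWeakDerivLine_profile h j hn).hasWeakDeriv_snd hw U) (.inr rfl)

lemma hasWeakDeriv_mode_profile (h : Admissible k α) (hF : IsDensity M ρ F) (j : ℤ)
    (U : Set (ℝ × ℝ)) {m : ℕ × ℕ} (hm : m.2 ≤ 2) :
    HasWeakDeriv U m (mode α j (profile k α F j 0))
      (mode α j fun t => (Complex.I * (alphaj α j : ℂ)) ^ m.1 * profile k α F j m.2 t) := by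
  have hwave : LocallyIntegrable fun t =>
      (Complex.I * (alphaj α j : ℂ)) ^ m.1 * planeWave (alphaj α j) t :=
    (continuous_const.mul (continuous_planeWave _)).locallyIntegrable
  have fst := hasWeakDeriv_planeWave_mul (alphaj α j)
    (hF.hasWeakDerivLine_profile h j two_pos).locallyIntegrable U m.1
  convert fst.trans (hF.hasWeakDeriv_mul_profile h j hwave U hm) (.inl rfl) using 1
  · simp
  · rfl
  · funext x
    rw [mode]
    ring

end IsDensity

lemma Admissible.exists_hasWeakDeriv_potential {k : ℂ} {α : ℝ} (h : Admissible k α)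
    {m : ℕ × ℕ} (hm : m.1 + m.2 ≤ 2) (M : ℕ) (ρ : ℝ) (N : ℕ) (R : ℝ) :
    ∃ C : ℝ≥0, ∀ {F}, IsDensity M ρ F → ∃ v, HasWeakDeriv (box N R) m (potential k α F) v ∧
      MemLp v 2 (volume.restrict (box N R)) ∧
      eLpNorm v 2 (volume.restrict (box N R)) ^ 2 ≤ C * ∫⁻ y, ‖F y‖ₑ ^ 2 := by
  obtain ⟨C, hC⟩ := h.exists_lintegral_profile_sq_le hm M ρ R
  refine ⟨Real.toNNReal (2 * (N * Real.pi)) * (C * Real.toNNReal (2 * (M * Real.pi))),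
    fun {F} hF => ?_⟩
  have : IsFiniteMeasure (volume.restrict (box N R)) :=
    isFiniteMeasure_restrict.mpr (volume_box_lt_top N R).ne
  have tsum_le : ∑' j, ∫⁻ t in Set.Ioo (-R) R,
      ‖(Complex.I * (alphaj α j : ℂ)) ^ m.1 * profile k α F j m.2 t‖ₑ ^ 2
      ≤ C * (ENNReal.ofReal (2 * (M * Real.pi)) * ∫⁻ y, ‖F y‖ₑ ^ 2) := by
    refine (ENNReal.tsum_le_tsum (hC hF)).trans ?_
    rw [ENNReal.tsum_mul_left]
    gcongr
    exact hF.tsum_lintegral_coeff_sq_le α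
  obtain ⟨v, hv, hv_le, hv_sum⟩ := exists_memLp_hasSum_integral_mode_mul α
    (fun j => (hF.measurable_profile k α j m.2).const_mul _) N R
    (tsum_le.trans_lt (ENNReal.mul_lt_top ENNReal.coe_lt_top
      (ENNReal.mul_lt_top ENNReal.ofReal_lt_top hF.lintegral_enorm_sq_lt_top)))
  refine ⟨v, .of_hasSum (fun j => hF.hasWeakDeriv_mode_profile h j (box N R) (by omega))
    ?_ ?_ (fun φ hφ => ?_) (fun φ hφ => ?_), hv, ?_⟩
  · have := (hF.integrableOn_potential_mul_and_hasSum h N R (χ := 1) measurable_const (K := 1)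
      (by simp)).1
    simp only [Pi.one_apply, mul_one] at this
    exact this.locallyIntegrableOn
  · exact IntegrableOn.locallyIntegrableOn (hv.integrable one_le_two)
  · obtain ⟨K, hK⟩ := hφ.exists_norm_le
    exact (hF.integrableOn_potential_mul_and_hasSum h N R
      hφ.contDiff.continuous.measurable hK).2
  · obtain ⟨K, hK⟩ := hφ.exists_norm_le
    exact hv_sum φ (.of_bound hφ.contDiff.continuous.aestronglyMeasurable K (.of_forall hK))
  · refine hv_le.trans ((mul_le_mul_right tsum_le _).trans_eq ?_)
    rw [ENNReal.coe_mul, ENNReal.coe_mul, mul_assoc, mul_assoc]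
    rfl

/-! ### Mapping properties -/

lemma isQuasiPeriodic_green (k : ℂ) (α : ℝ) : IsQuasiPeriodic α (green k α) := by
  intro x₁ x₂
  have exp_periodic (j : ℤ) :
      Complex.exp (Complex.I * (alphaj α j : ℂ) * ((x₁ + 2 * Real.pi : ℝ) : ℂ)
          + Complex.I * betaj k α j * ((|x₂| : ℝ) : ℂ))
        = Complex.exp (2 * (Real.pi : ℂ) * Complex.I * (α : ℂ)) * Complex.exp (Complex.I *
          (alphaj α j : ℂ) * (x₁ : ℂ) + Complex.I * betaj k α j * ((|x₂| : ℝ) : ℂ)) := by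
    rw [← Complex.exp_add, Complex.exp_eq_exp_iff_exists_int]
    exact ⟨j, by push_cast [alphaj]; ring⟩
  simp only [green, exp_periodic, mul_left_comm _ (Complex.exp (2 * _ * _ * _)), tsum_mul_left]

lemma isQuasiPeriodic_potential (k : ℂ) (α : ℝ) (F : ℝ × ℝ → ℂ) :
    IsQuasiPeriodic α (potential k α F) := by
  intro x₁ x₂
  simp only [potential, ← integral_const_mul, ← mul_assoc]
  congr 1 with y
  rw [← Prod.mk.eta (p := y), Prod.mk_sub_mk, Prod.mk_sub_mk, ← isQuasiPeriodic_green,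
    add_sub_right_comm]

lemma isBounded_cell (R : ℝ) : Bornology.IsBounded (cell R) :=
  (Metric.isBounded_Ioo _ _).prod (Metric.isBounded_Ioo _ _)

lemma isBounded_disc (c : ℝ × ℝ) (r : ℝ) : Bornology.IsBounded (disc c r) := by
  refine Metric.isBounded_ball (x := c) (r := |r|) |>.subset fun x hx => ?_
  have hx : (x.1 - c.1) ^ 2 + (x.2 - c.2) ^ 2 < r ^ 2 := hx
  rw [Metric.mem_ball, Prod.dist_eq, max_lt_iff, Real.dist_eq, Real.dist_eq]
  exact ⟨sq_lt_sq.mp (by linarith [sq_nonneg (x.2 - c.2)]),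
    sq_lt_sq.mp (by linarith [sq_nonneg (x.1 - c.1)])⟩

lemma normH_le {ℓ : ℕ} {U : Set (ℝ × ℝ)} (hU : IsOpen U) {u : ℝ × ℝ → ℂ} {B : ℕ × ℕ → ℝ≥0∞}
    (h : ∀ m : ℕ × ℕ, m.1 + m.2 ≤ ℓ → ∃ v, HasWeakDeriv U m u v ∧
      eLpNorm v 2 (volume.restrict U) ^ 2 ≤ B m) :
    normH ℓ U u ≤ (∑ n ∈ Finset.range (ℓ + 1), ∑ m ∈ Finset.HasAntidiagonal.antidiagonal n, B m)
      ^ (1 / 2 : ℝ) := by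
  unfold normH
  gcongr with n hn m hm
  obtain ⟨v, hv, hB⟩ := h m (by
    rw [Finset.HasAntidiagonal.mem_antidiagonal.mp hm]
    exact Nat.lt_succ_iff.mp (Finset.mem_range.mp hn))
  rwa [hv.eLpNorm_weakDeriv hU]

namespace Admissible

variable {k : ℂ} {α : ℝ}

lemma exists_normH_potential_le (h : Admissible k α) (M : ℕ) (ρ : ℝ) (N : ℕ) (R : ℝ) :
    ∃ C : ℝ≥0, ∀ {F}, IsDensity M ρ F → normH 2 (box N R) (potential k α F) ≤ C * eLpNorm F 2 := by
  choose! C hC using fun m : ℕ × ℕ => fun hm : m.1 + m.2 ≤ 2 =>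
    h.exists_hasWeakDeriv_potential hm M ρ N R
  refine ⟨(∑ n ∈ Finset.range 3, ∑ m ∈ Finset.HasAntidiagonal.antidiagonal n, C m) ^ (1 / 2 : ℝ),
    fun {F} hF => ?_⟩
  refine (normH_le (isOpen_box N R) (B := fun m => C m * eLpNorm F 2 ^ 2)
    fun m hm => ?_).trans_eq ?_
  · obtain ⟨v, hv, -, hv_le⟩ := hC m hm hF
    exact ⟨v, hv, hv_le.trans_eq (by rw [eLpNorm_two_sq])⟩
  · simp only [← Finset.sum_mul]
    rw [ENNReal.mul_rpow_of_nonneg _ _ (by norm_num), ← ENNReal.rpow_natCast_mul,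
      ENNReal.coe_rpow_of_nonneg _ (by norm_num)]
    norm_num

lemma memH_potential (h : Admissible k α) {M : ℕ} {ρ : ℝ} {F : ℝ × ℝ → ℂ} (hF : IsDensity M ρ F)
    {U : Set (ℝ × ℝ)} (hU : Bornology.IsBounded U) : MemH 2 U (potential k α F) := by
  obtain ⟨N, R, hUbox⟩ := exists_subset_box hU
  refine MemH.mono (fun m hm => ?_) hUbox
  obtain ⟨C, hC⟩ := h.exists_hasWeakDeriv_potential hm M ρ N R
  obtain ⟨v, hv, hv2, -⟩ := hC hF
  exact ⟨v, hv, hv2⟩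

lemma memHalpha_potential (h : Admissible k α) {M : ℕ} {ρ : ℝ} {F : ℝ × ℝ → ℂ}
    (hF : IsDensity M ρ F) (R : ℝ) : MemHalpha 2 α R (potential k α F) :=
  ⟨h.memH_potential hF (isBounded_cell R), potential k α F, isQuasiPeriodic_potential k α F,
    fun c r => h.memH_potential hF (isBounded_disc c r), .rfl⟩

end Admissible

section

variable {D : Set (ℝ × ℝ)}

lemma isDensity_indicator (hDm : MeasurableSet D) {M : ℕ} {ρ : ℝ} (hD : D ⊆ box M ρ)
    (f : Lp ℂ 2 ((volume : Measure (ℝ × ℝ)).restrict D)) : IsDensity M ρ (D.indicator f) where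
  measurable := (Lp.stronglyMeasurable f).measurable.indicator hDm
  eq_zero _ hy := Set.indicator_of_notMem (fun h => hy (hD h)) _
  memLp := (memLp_indicator_iff_restrict hDm).mpr (Lp.memLp f)

lemma mul_indicator_eq (g f : ℝ × ℝ → ℂ) :
    (fun y => g y * D.indicator f y) = D.indicator fun y => g y * f y := by
  funext y
  exact (Set.indicator_mul_right D g f).symm

lemma volumePotential_eq_potential (hDm : MeasurableSet D) (k : ℂ) (α : ℝ)
    (f : Lp ℂ 2 ((volume : Measure (ℝ × ℝ)).restrict D)) :
    volumePotential k α D f = potential k α (D.indicator f) := by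
  funext x
  rw [volumePotential, potential, mul_indicator_eq, integral_indicator hDm]

lemma isLinearMap_volumePotential {k : ℂ} {α : ℝ}
    (hi : ∀ (f : Lp ℂ 2 ((volume : Measure (ℝ × ℝ)).restrict D)) (x : ℝ × ℝ),
      IntegrableOn (fun y => green k α (x - y) * f y) D) :
    IsLinearMap ℂ (volumePotential k α D) where
  map_add f g := by
    funext x
    simp only [volumePotential, Pi.add_apply]
    rw [← integral_add (hi f x) (hi g x)]
    refine integral_congr_ae ?_
    filter_upwards [Lp.coeFn_add f g] with y hy
    rw [hy, Pi.add_apply, mul_add]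
  map_smul c f := by
    funext x
    simp only [volumePotential, Pi.smul_apply, smul_eq_mul]
    rw [← integral_const_mul]
    refine integral_congr_ae ?_
    filter_upwards [Lp.coeFn_smul c f] with y hy
    rw [hy, Pi.smul_apply, smul_eq_mul, mul_left_comm]

end

end QPVolumePotential

open QPVolumePotential in
theorem mainTheorem7_general {k : ℂ} (hk : 0 ≤ (k ^ 2).im) {α : ℝ}
    (hkα : ∀ j : ℤ, k ^ 2 ≠ (alphaj α j : ℂ) ^ 2) {D : Set (ℝ × ℝ)} (hDm : MeasurableSet D)
    (hD : Bornology.IsBounded D) :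
    (∀ (f : Lp ℂ 2 ((volume : Measure (ℝ × ℝ)).restrict D)) (x : ℝ × ℝ),
      IntegrableOn (fun y => green k α (x - y) * f y) D) ∧
    IsLinearMap ℂ (volumePotential k α D) ∧
    ∀ R : ℝ,
      (∀ f : Lp ℂ 2 ((volume : Measure (ℝ × ℝ)).restrict D),
        MemHalpha 2 α R (volumePotential k α D f)) ∧
      ∃ C : ℝ≥0, ∀ f : Lp ℂ 2 ((volume : Measure (ℝ × ℝ)).restrict D),
        normH 2 (cell R) (volumePotential k α D f) ≤ (C : ℝ≥0∞) * ‖f‖ₑ := by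
  have h : Admissible k α := ⟨hk, hkα⟩
  obtain ⟨M, ρ, hDbox⟩ := exists_subset_box hD
  have density := isDensity_indicator hDm hDbox
  have integrableOn (f : Lp ℂ 2 ((volume : Measure (ℝ × ℝ)).restrict D)) (x : ℝ × ℝ) :
      IntegrableOn (fun y => green k α (x - y) * f y) D := by
    rw [← integrable_indicator_iff hDm, ← mul_indicator_eq]
    exact ((density f).integrable_green_mul_and_hasSum h x).1
  refine ⟨integrableOn, isLinearMap_volumePotential integrableOn, fun R => ⟨fun f => ?_, ?_⟩⟩
  · rw [volumePotential_eq_potential hDm]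
    exact h.memHalpha_potential (density f) R
  · obtain ⟨C, hC⟩ := h.exists_normH_potential_le M ρ 1 R
    refine ⟨C, fun f => ?_⟩
    rw [volumePotential_eq_potential hDm, ← box_one, Lp.enorm_def,
      ← eLpNorm_indicator_eq_eLpNorm_restrict hDm]
    exact hC (density f)

theorem mainTheorem7 (k : ℂ) (hk_re : 0 ≤ k.re) (hk_im : 0 ≤ k.im) (α : ℝ)
    (hkα : ∀ j : ℤ, k ^ 2 ≠ (QPVolumePotential.alphaj α j : ℂ) ^ 2)
    (ρ : ℝ) (D : Set (ℝ × ℝ)) (hDm : MeasurableSet D) (hD : D ⊆ QPVolumePotential.cell ρ) :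
    (∀ (f : Lp ℂ 2 ((volume : Measure (ℝ × ℝ)).restrict D)) (x : ℝ × ℝ),
      IntegrableOn (fun y => QPVolumePotential.green k α (x - y) * f y) D) ∧
    IsLinearMap ℂ (QPVolumePotential.volumePotential k α D) ∧
    ∀ R : ℝ, 0 < R →
      (∀ f : Lp ℂ 2 ((volume : Measure (ℝ × ℝ)).restrict D),
        QPVolumePotential.MemHalpha 2 α R (QPVolumePotential.volumePotential k α D f)) ∧
      ∃ C : ℝ≥0, ∀ f : Lp ℂ 2 ((volume : Measure (ℝ × ℝ)).restrict D),
        QPVolumePotential.normH 2 (QPVolumePotential.cell R)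
          (QPVolumePotential.volumePotential k α D f) ≤ (C : ℝ≥0∞) * ‖f‖ₑ := by
  have hk : 0 ≤ (k ^ 2).im := by
    rw [sq, Complex.mul_im]
    positivity
  obtain ⟨integrable, linear, bounded⟩ := mainTheorem7_general hk hkα hDm
    ((QPVolumePotential.isBounded_cell ρ).subset hD)
  exact ⟨integrable, linear, fun R _ => bounded R⟩
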